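/- Let $n\ge 2$. **DAGs.** Let $\mathscr F_{n,3}$ be the set of directed multigraphs $G$ on the vertex set $\{1,\dots,n+1\}$, all of whose edges $(i,j)$ satisfy $i<j$, with out-degree sequence $(3,2,\dots,2,0)$ and in-degree sequence $(0,2,\dots,2,3)$. **Embedding convention.** The edge multiset of each $G\in\mathscr F_{n,3}$ decomposes uniquely into three directed paths from $1$ to $n+1$: the spine, consisting of one copy of each edge $e_i=(i,i+1)$, $1\le i\le n$; a path $A$ that begins with the other copy of the edge $(1,2)$; and a path $B$. Draw $G$ in the plane with vertex $i$ at the point $(i,0)$, the spine edges as horizontal segments, the edges of $A$ as semicircles below the horizontal axis, and the edges of $B$ as semicircles above it. The truncated dual $G^*$ is the dual graph of this plane drawing with the vertex of the unbounded face deleted: its vertices are the bounded faces, and each edge of $G$ that separates two bounded faces gives an edge between them. The faces below the spine are the vertices of rank $0$, those above the spine are the vertices of rank $1$, and the vertices of each rank are ordered from left to right. **Trees.** A bipartite non-crossing tree on $N$ vertices is a tree whose vertices are $x_1,\dots,x_l$ (of rank $0$) and $y_1,\dots,y_r$ (of rank $1$), where $l+r=N$, all of whose edges are of the form $x_iy_j$,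 and which has no two edges $x_iy_j$ and $x_{i'}y_{j'}$ with $i<i'$ and $j'<j$. Two such trees are the same if they have the same $l$, $r$ and edge set. The left-most vertex of rank $0$ is $x_1$. **Statement.** There are exactly $2^{n-1}$ bipartite non-crossing trees on $n+1$ vertices. Exactly $2^{n-2}$ of them are realizable, that is, equal to the truncated dual $G^*$ of some $G\in\mathscr F_{n,3}$ drawn with the convention above. A bipartite non-crossing tree on $n+1$ vertices is realizable if and only if its left-most vertex of rank $0$ has degree $1$. -/

import Mathlib

/-- A finite directed acyclic multigraph on the vertices `0, 1, …, n` (standing for `1, …, n + 1`):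
a multiset of edges `(i, j)`, each of which satisfies `i < j`. -/
structure DAG (n : ℕ) where
  edges : Multiset (Fin (n + 1) × Fin (n + 1))
  lt_of_mem : ∀ e ∈ edges, e.1 < e.2

namespace DAG

/-- The number of edges that leave `i`, with multiplicity. -/
def outDegree {n : ℕ} (G : DAG n) (i : Fin (n + 1)) : ℕ :=
  G.edges.countP (fun e => e.1 = i)

/-- The number of edges that enter `i`, with multiplicity. -/
def inDegree {n : ℕ} (G : DAG n) (i : Fin (n + 1)) : ℕ :=
  G.edges.countP (fun e => e.2 = i)

/-- The family of full DAGs with source degree `k`: the out-degree sequence is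
`(k, 2, …, 2, 0)` and the in-degree sequence is `(0, 2, …, 2, k)`. -/
def fullFamily (n k : ℕ) : Set (DAG n) :=
  {G | G.outDegree 0 = k ∧ G.inDegree 0 = 0 ∧
    (∀ i : Fin (n + 1), i ≠ 0 → i ≠ Fin.last n → G.outDegree i = 2 ∧ G.inDegree i = 2) ∧
    G.outDegree (Fin.last n) = 0 ∧ G.inDegree (Fin.last n) = k}

end DAG

/-- How an edge is drawn: as a segment of the horizontal axis, or as a semicircle below or above
that axis. -/
inductive Side where
  | spine
  | below
  | above
  deriving DecidableEq

/-- An edge `(i, j)` together with the way in which it is drawn. -/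
abbrev DrawnEdge (n : ℕ) : Type := Side × Fin (n + 1) × Fin (n + 1)

/-- The curve that represents a drawn edge, where vertex `i` is the point `(i, 0)`. -/
def DrawnEdge.arc {n : ℕ} : DrawnEdge n → Set (ℝ × ℝ)
  | (Side.spine, i, j) => {p | ((i : ℕ) : ℝ) ≤ p.1 ∧ p.1 ≤ ((j : ℕ) : ℝ) ∧ p.2 = 0}
  | (Side.below, i, j) =>
      {p | (p.1 - (((i : ℕ) : ℝ) + ((j : ℕ) : ℝ)) / 2) ^ 2 + p.2 ^ 2
          = ((((j : ℕ) : ℝ) - ((i : ℕ) : ℝ)) / 2) ^ 2 ∧ p.2 ≤ 0}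
  | (Side.above, i, j) =>
      {p | (p.1 - (((i : ℕ) : ℝ) + ((j : ℕ) : ℝ)) / 2) ^ 2 + p.2 ^ 2
          = ((((j : ℕ) : ℝ) - ((i : ℕ) : ℝ)) / 2) ^ 2 ∧ 0 ≤ p.2}

/-- `S` is the set of edges of a directed path from the first vertex to the last one. -/
def IsSourceSinkPath {n : ℕ} (S : Set (Fin (n + 1) × Fin (n + 1))) : Prop :=
  ∃ p : List (Fin (n + 1)), p.head? = some 0 ∧ p.getLast? = some (Fin.last n) ∧
    p.IsChain (· < ·) ∧ S = {e | e ∈ p.zip p.tail}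

/-- A drawing, given by its finite set of drawn edges. -/
abbrev Drawing (n : ℕ) : Type := Finset (DrawnEdge n)

namespace Drawing

variable {n : ℕ}

/-- The edges of the drawing that are drawn on the given side. -/
def sideEdges (D : Drawing n) (s : Side) : Set (Fin (n + 1) × Fin (n + 1)) :=
  {e | (s, e) ∈ D}

/-- `D` draws `G` according to the planar embedding convention: the edge multiset of `G` is split
into the spine (one copy of each `(i, i + 1)`), drawn on the axis; a path `A` from source to sink
that begins with a (second) copy of the edge from the first to the second vertex, drawn below the
axis; and a path `B` from source to sink, drawn above the axis. -/
def IsConventional (D : Drawing n) (G : DAG n) : Prop :=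
  D.val.map Prod.snd = G.edges ∧
  D.sideEdges Side.spine = {e | (e.2 : ℕ) = (e.1 : ℕ) + 1} ∧
  IsSourceSinkPath (D.sideEdges Side.below) ∧
  (0, 1) ∈ D.sideEdges Side.below ∧
  IsSourceSinkPath (D.sideEdges Side.above)

/-- The subset of the plane covered by the drawing. -/
def support (D : Drawing n) : Set (ℝ × ℝ) := ⋃ e ∈ D, DrawnEdge.arc e

/-- The faces: the connected components of the complement of the drawing in the plane. -/
def faces (D : Drawing n) : Set (Set (ℝ × ℝ)) :=
  {F | ∃ p ∈ D.supportᶜ, F = connectedComponentIn D.supportᶜ p}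

/-- The bounded faces. -/
def boundedFaces (D : Drawing n) : Set (Set (ℝ × ℝ)) :=
  {F | F ∈ D.faces ∧ Bornology.IsBounded F}

/-- The faces that have the drawn edge `e` on their boundary. -/
def incidentFaces (D : Drawing n) (e : DrawnEdge n) : Set (Set (ℝ × ℝ)) :=
  {F | F ∈ D.faces ∧ DrawnEdge.arc e ⊆ frontier F}

/-- The edges of the dual multigraph between `F` and `F'`: one for each edge of the drawing whose
incident faces are exactly `F` and `F'` (a loop if `F = F'`). -/
def dualEdges (D : Drawing n) (F F' : Set (ℝ × ℝ)) : Set (DrawnEdge n) :=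
  {e | e ∈ D ∧ D.incidentFaces e = {F, F'}}

end Drawing

/-- `F` lies to the left of `F'`. -/
def IsLeftOf (F F' : Set (ℝ × ℝ)) : Prop := ∀ p ∈ F, ∀ q ∈ F', p.1 < q.1

/-- The bipartite graph with rank-0 vertices `Sum.inl i`, rank-1 vertices `Sum.inr j` and
edge set `E`. -/
def bipartiteGraph {l r : ℕ} (E : Finset (Fin l × Fin r)) : SimpleGraph (Fin l ⊕ Fin r) :=
  SimpleGraph.fromRel (fun u v => ∃ e ∈ E, u = Sum.inl e.1 ∧ v = Sum.inr e.2)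

/-- Bipartite non-crossing trees with `l` rank-0 vertices `x_0, …, x_{l-1}` and `r` rank-1
vertices `y_0, …, y_{r-1}`, placed from left to right on two parallel horizontal lines. The edges
`(x_i, y_j)` and `(x_{i'}, y_{j'})` with `i < i'` cross if and only if `j' < j`. -/
structure RankedNoncrossingTree (l r : ℕ) where
  edges : Finset (Fin l × Fin r)
  isTree : (bipartiteGraph edges).IsTree
  noncrossing : ∀ e ∈ edges, ∀ f ∈ edges, e.1 < f.1 → e.2 ≤ f.2

/-- The bipartite non-crossing trees on `N` vertices. -/
abbrev BipartiteNoncrossingTree (N : ℕ) : Type :=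
  Σ lr : Finset.HasAntidiagonal.antidiagonal N, RankedNoncrossingTree lr.1.1 lr.1.2

/-- The left-most rank-0 vertex of the tree has degree `1`. -/
def RankedNoncrossingTree.LeftmostHasDegreeOne {l r : ℕ} (T : RankedNoncrossingTree l r) : Prop :=
  ∃ h : 0 < l, ((bipartiteGraph T.edges).neighborSet (Sum.inl ⟨0, h⟩)).ncard = 1

/-- `T` is the truncated dual of the drawing `D`: the vertices of `T` are the bounded faces of `D`,
the rank-0 vertices being the faces below the spine and the rank-1 vertices the faces above it,
both numbered from left to right, and the edges of `T` are the dual edges between them. -/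
def RankedNoncrossingTree.IsTruncatedDualOf {l r n : ℕ} (T : RankedNoncrossingTree l r)
    (D : Drawing n) : Prop :=
  ∃ φ : (Fin l ⊕ Fin r) ≃ D.boundedFaces,
    (∀ i : Fin l, (φ (Sum.inl i) : Set (ℝ × ℝ)) ⊆ {p | p.2 < 0}) ∧
    (∀ j : Fin r, (φ (Sum.inr j) : Set (ℝ × ℝ)) ⊆ {p | 0 < p.2}) ∧
    (∀ i i' : Fin l, i < i' → IsLeftOf (φ (Sum.inl i)) (φ (Sum.inl i'))) ∧
    (∀ j j' : Fin r, j < j' → IsLeftOf (φ (Sum.inr j)) (φ (Sum.inr j'))) ∧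
    (∀ u v : Fin l ⊕ Fin r, (bipartiteGraph T.edges).Adj u v →
      (D.dualEdges (φ u) (φ v)).ncard = 1) ∧
    (∀ u v : Fin l ⊕ Fin r, ¬ (bipartiteGraph T.edges).Adj u v →
      D.dualEdges (φ u) (φ v) = ∅)

/-- `T` is realizable: it is the truncated dual of a member of the family `fullFamily n 3`, drawn
according to the planar embedding convention. -/
def IsRealizable (n : ℕ) (T : BipartiteNoncrossingTree (n + 1)) : Prop :=
  ∃ G ∈ DAG.fullFamily n 3, ∃ D : Drawing n, D.IsConventional G ∧ T.2.IsTruncatedDualOf D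

/-!
The proof separates the plane topology of the drawings from the combinatorics of the trees.

*Topology.* The edges on one side of the spine are semicircles over intervals that tile the axis
(`IsTiling`). The open half-disc between such a semicircle and the axis is convex, avoids the
drawing and has its boundary in the drawing, so it is a face. Every other point of the complement
lies in the exterior of one of the two sides, which is joined by vertical rays to a far half-plane,
so that its face is unbounded. Hence the bounded faces are exactly these half-discs
(`Drawing.IsTiled.mem_boundedFaces`). A semicircle also borders the unbounded face, and a spine edge
borders the two half-discs over the tiles that contain it, so the truncated dual has one edge for
each spine edge (`Drawing.IsTiled.mem_dualEdges`).

*Trees.* A bipartite non-crossing tree on `n + 1` vertices has `n` edges `(i, j)`, which form a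
chain for the product order. Along a chain `i + j` is strictly increasing, and it takes values below
`n`; so it takes each value once, and the edges are the points of a lattice path with unit steps
(`RankedNoncrossingTree.exists_isStaircase`). Conversely each lattice path gives a tree. The set
`S ⊆ {1, …, n - 1}` of the numbers of the horizontal steps is arbitrary, which gives `2 ^ (n - 1)`
trees. The left-most rank-0 vertex has degree one if and only if the first step is horizontal, that
is, `1 ∈ S`, which holds for `2 ^ (n - 2)` of them.

*Realizability.* In a conventional drawing the left-most face below the spine is the half-disc of the edge
from the first to the second vertex, hence borders a single spine edge
(`RankedNoncrossingTree.IsTruncatedDualOf.leftmostHasDegreeOne`). Conversely, if `1 ∈ S`, the path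
through the vertices in `S` is drawn below the spine and the path through the other vertices above
it. The degree conditions hold because each inner vertex lies on exactly one of the two paths, and
the spine edge from `k` to `k + 1` is covered by the two tiles whose numbers are the coordinates of
the lattice path after `k` steps (`IsStaircase.isTruncatedDualOf`).
-/

/-! ### Half-discs and the drawing -/

/-- The sign of the half-plane into which an edge is drawn; it is `0` for spine edges. -/
def Side.sign : Side → ℝ
  | Side.spine => 0
  | Side.below => -1
  | Side.above => 1

theorem Side.sign_mul_self {s : Side} (hs : s ≠ Side.spine) : s.sign * s.sign = 1 := by
  cases s <;> simp_all [Side.sign]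

theorem Side.eq_of_sign_mul_pos {s t : Side} {y : ℝ} (hs : 0 < s.sign * y)
    (ht : 0 ≤ t.sign * y) (hs' : s ≠ Side.spine) (ht' : t ≠ Side.spine) : s = t := by
  cases s <;> cases t <;> simp_all [Side.sign] <;> linarith

namespace DrawnEdge

variable {n : ℕ}

/-- The power of a point with respect to the circle whose diameter is the segment from vertex `i`
to vertex `j`, where `e` is the edge `(i, j)`. -/
def power (e : DrawnEdge n) (p : ℝ × ℝ) : ℝ :=
  (p.1 - ((e.2.1 : ℕ) : ℝ)) * (p.1 - ((e.2.2 : ℕ) : ℝ)) + p.2 ^ 2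

/-- The open half-disc between a semicircular edge and the axis; it is empty for spine edges. -/
def halfDisc (e : DrawnEdge n) : Set (ℝ × ℝ) := {p | e.power p < 0 ∧ 0 < e.1.sign * p.2}

theorem mem_arc {e : DrawnEdge n} (he : e.1 ≠ Side.spine) {p : ℝ × ℝ} :
    p ∈ e.arc ↔ e.power p = 0 ∧ 0 ≤ e.1.sign * p.2 := by
  obtain ⟨s, i, j⟩ := e
  cases s
  · exact absurd rfl he
  · simp only [arc, power, Side.sign, Set.mem_ofPred_eq]
    constructor <;> rintro ⟨h1, h2⟩ <;> constructor <;> linarith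
  · simp only [arc, power, Side.sign, Set.mem_ofPred_eq]
    constructor <;> rintro ⟨h1, h2⟩ <;> constructor <;> linarith

theorem continuous_power (e : DrawnEdge n) : Continuous e.power := by
  unfold power; fun_prop

theorem isOpen_halfDisc (e : DrawnEdge n) : IsOpen e.halfDisc :=
  (isOpen_lt e.continuous_power continuous_const).inter
    (isOpen_lt continuous_const (continuous_const.mul continuous_snd))

theorem closure_halfDisc_subset (e : DrawnEdge n) :
    closure e.halfDisc ⊆ {p | e.power p ≤ 0 ∧ 0 ≤ e.1.sign * p.2} := by
  refine closure_minimal (fun p hp => ⟨hp.1.le, hp.2.le⟩) ?_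
  exact (isClosed_le e.continuous_power continuous_const).inter
    (isClosed_le continuous_const (continuous_const.mul continuous_snd))

/-- The power is a strictly convex function of the point. -/
theorem power_combo (e : DrawnEdge n) (p q : ℝ × ℝ) {a b : ℝ} (hab : a + b = 1) :
    e.power (a • p + b • q) =
      a * e.power p + b * e.power q - a * b * ((p.1 - q.1) ^ 2 + (p.2 - q.2) ^ 2) := by
  obtain rfl : a = 1 - b := by linarith
  simp only [power, Prod.fst_add, Prod.snd_add, Prod.smul_fst, Prod.smul_snd, smul_eq_mul]
  ring

theorem combo_mem_halfDisc {e : DrawnEdge n} {p q : ℝ × ℝ} (hp : e.power p ≤ 0)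
    (hp' : 0 ≤ e.1.sign * p.2) (hq : q ∈ e.halfDisc) {a b : ℝ} (ha : 0 ≤ a) (hb : 0 < b)
    (hab : a + b = 1) : a • p + b • q ∈ e.halfDisc := by
  constructor
  · rw [power_combo e p q hab]
    have h1 : b * e.power q < 0 := mul_neg_of_pos_of_neg hb hq.1
    have h2 : a * e.power p ≤ 0 := mul_nonpos_of_nonneg_of_nonpos ha hp
    have h3 : 0 ≤ a * b * ((p.1 - q.1) ^ 2 + (p.2 - q.2) ^ 2) := by positivity
    linarith
  · have h1 := mul_pos hb hq.2
    have h2 := mul_nonneg ha hp'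
    simp only [Prod.snd_add, Prod.smul_snd, smul_eq_mul]
    linarith

theorem convex_halfDisc (e : DrawnEdge n) : Convex ℝ e.halfDisc := by
  intro p hp q hq a b ha hb hab
  rcases hb.eq_or_lt with rfl | hb
  · obtain rfl : a = 1 := by linarith
    simpa using hp
  · exact combo_mem_halfDisc hp.1.le hp.2.le hq ha hb hab

/-- A point of the half-disc, halfway between its centre and its lowest or highest point. -/
noncomputable def apex (e : DrawnEdge n) : ℝ × ℝ :=
  ((((e.2.1 : ℕ) : ℝ) + ((e.2.2 : ℕ) : ℝ)) / 2,
    e.1.sign * ((((e.2.2 : ℕ) : ℝ) - ((e.2.1 : ℕ) : ℝ)) / 4))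

theorem apex_mem {e : DrawnEdge n} (he : e.1 ≠ Side.spine) (hlt : e.2.1 < e.2.2) :
    e.apex ∈ e.halfDisc := by
  have h1 := Side.sign_mul_self he
  have h2 : ((e.2.1 : ℕ) : ℝ) < ((e.2.2 : ℕ) : ℝ) := by exact_mod_cast hlt
  constructor
  · have : e.power e.apex = -(((e.2.2 : ℕ) : ℝ) - ((e.2.1 : ℕ) : ℝ)) ^ 2 / 4 +
        (e.1.sign * e.1.sign) * (((e.2.2 : ℕ) : ℝ) - ((e.2.1 : ℕ) : ℝ)) ^ 2 / 16 := by
      simp only [power, apex]; ring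
    rw [this, h1]
    nlinarith [pow_pos (sub_pos.2 h2) 2]
  · simp only [apex]
    rw [← mul_assoc, h1]
    linarith

/-- The half-disc is dense in its closed counterpart. -/
theorem mem_closure_halfDisc {e : DrawnEdge n} (he : e.1 ≠ Side.spine) (hlt : e.2.1 < e.2.2)
    {p : ℝ × ℝ} (hp : e.power p ≤ 0) (hp' : 0 ≤ e.1.sign * p.2) : p ∈ closure e.halfDisc := by
  have hsub : openSegment ℝ p e.apex ⊆ e.halfDisc := by
    rintro _ ⟨a, b, ha, hb, hab, rfl⟩
    exact combo_mem_halfDisc hp hp' (apex_mem he hlt) ha.le hb hab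
  refine closure_mono hsub ?_
  rw [closure_openSegment]
  exact left_mem_segment ℝ _ _

theorem lt_of_power_neg {e : DrawnEdge n} (hlt : e.2.1 < e.2.2) {p : ℝ × ℝ} (hp : e.power p < 0) :
    ((e.2.1 : ℕ) : ℝ) < p.1 ∧ p.1 < ((e.2.2 : ℕ) : ℝ) := by
  have h2 : ((e.2.1 : ℕ) : ℝ) < ((e.2.2 : ℕ) : ℝ) := by exact_mod_cast hlt
  unfold power at hp
  constructor <;> by_contra! h <;> nlinarith [sq_nonneg p.2]

theorem le_of_power_nonpos {e : DrawnEdge n} (hlt : e.2.1 < e.2.2) {p : ℝ × ℝ}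
    (hp : e.power p ≤ 0) : ((e.2.1 : ℕ) : ℝ) ≤ p.1 ∧ p.1 ≤ ((e.2.2 : ℕ) : ℝ) := by
  have h2 : ((e.2.1 : ℕ) : ℝ) < ((e.2.2 : ℕ) : ℝ) := by exact_mod_cast hlt
  unfold power at hp
  constructor <;> by_contra! h <;> nlinarith [sq_nonneg p.2]

theorem vertex_le (i : Fin (n + 1)) : ((i : ℕ) : ℝ) ≤ n := by
  exact_mod_cast Nat.le_of_lt_succ i.2

theorem isBounded_halfDisc {e : DrawnEdge n} (hlt : e.2.1 < e.2.2) :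
    Bornology.IsBounded e.halfDisc := by
  refine (Metric.isBounded_Icc ((0 : ℝ), -(n : ℝ)) ((n : ℝ), (n : ℝ))).subset ?_
  rintro p ⟨hp, -⟩
  obtain ⟨h1, h2⟩ := lt_of_power_neg hlt hp
  have h3 := vertex_le e.2.2
  have h4 : (0 : ℝ) ≤ ((e.2.1 : ℕ) : ℝ) := Nat.cast_nonneg _
  unfold power at hp
  have h5 : p.2 ^ 2 ≤ (n : ℝ) ^ 2 := by nlinarith
  have h6 := abs_le_of_sq_le_sq' h5 (Nat.cast_nonneg _)
  exact ⟨⟨by simp; linarith, by simpa using h6.1⟩, ⟨by simp; linarith, by simpa using h6.2⟩⟩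

end DrawnEdge

/-- The pairs in `P` are the ends of intervals that tile the axis from the first vertex to the
last one. -/
structure IsTiling {n : ℕ} (P : Set (Fin (n + 1) × Fin (n + 1))) : Prop where
  lt : ∀ e ∈ P, e.1 < e.2
  eq_or_le : ∀ e ∈ P, ∀ f ∈ P, e = f ∨ e.2 ≤ f.1 ∨ f.2 ≤ e.1
  cover : ∀ k < n, ∃ e ∈ P, (e.1 : ℕ) ≤ k ∧ k < (e.2 : ℕ)

namespace Drawing

variable {n : ℕ}

/-- The drawing consists of the spine and, on each side of it, of the semicircles over a tiling of
the axis. -/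
structure IsTiled (D : Drawing n) : Prop where
  spine : D.sideEdges Side.spine = {e | (e.2 : ℕ) = (e.1 : ℕ) + 1}
  tiling : ∀ s ≠ Side.spine, IsTiling (D.sideEdges s)

namespace IsTiled

variable {D : Drawing n}

theorem lt (hD : D.IsTiled) {e : DrawnEdge n} (he : e ∈ D) (hs : e.1 ≠ Side.spine) :
    e.2.1 < e.2.2 :=
  (hD.tiling e.1 hs).lt e.2 he

theorem mem_support (hD : D.IsTiled) (hn : 0 < n) {p : ℝ × ℝ} :
    p ∈ D.support ↔ (p.2 = 0 ∧ 0 ≤ p.1 ∧ p.1 ≤ n) ∨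
      ∃ e ∈ D, e.1 ≠ Side.spine ∧ e.power p = 0 ∧ 0 ≤ e.1.sign * p.2 := by
  simp only [support, Set.mem_iUnion, exists_prop]
  constructor
  · rintro ⟨e, he, hp⟩
    by_cases hs : e.1 = Side.spine
    · left
      obtain ⟨s, i, j⟩ := e
      obtain rfl : s = Side.spine := hs
      obtain ⟨h1, h2, h3⟩ := hp
      exact ⟨h3, (Nat.cast_nonneg _).trans h1, h2.trans (DrawnEdge.vertex_le j)⟩
    · exact Or.inr ⟨e, he, hs, (DrawnEdge.mem_arc hs).1 hp⟩
  · rintro (⟨h0, h1, h2⟩ | ⟨e, he, hs, hp⟩)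
    · obtain ⟨k, hk, hk1, hk2⟩ : ∃ k < n, (k : ℝ) ≤ p.1 ∧ p.1 ≤ (k : ℝ) + 1 := by
        rcases h2.lt_or_eq with h | h
        · exact ⟨⌊p.1⌋₊, (Nat.floor_lt h1).2 h, Nat.floor_le h1, (Nat.lt_floor_add_one _).le⟩
        · refine ⟨n - 1, by omega, ?_, ?_⟩ <;>
            · rw [h, Nat.cast_sub hn]; push_cast; linarith
      refine ⟨(Side.spine, ⟨k, by omega⟩, ⟨k + 1, by omega⟩), ?_, ?_⟩
      · have : ((⟨k, by omega⟩, ⟨k + 1, by omega⟩) : Fin (n + 1) × Fin (n + 1)) ∈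
            D.sideEdges Side.spine := by rw [hD.spine]; rfl
        exact this
      · exact ⟨hk1, by push_cast; exact hk2, h0⟩
    · exact ⟨e, he, (DrawnEdge.mem_arc hs).2 hp⟩

/-- An open half-disc meets no other closed half-disc on its side of the axis. -/
theorem eq_of_power_nonpos (hD : D.IsTiled) {e f : DrawnEdge n} (he : e ∈ D) (hf : f ∈ D)
    (hs : e.1 ≠ Side.spine) (hef : e.1 = f.1) {p : ℝ × ℝ} (hp : e.power p < 0)
    (hp' : f.power p ≤ 0) : e = f := by
  obtain ⟨s, e⟩ := e
  obtain ⟨t, f⟩ := f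
  obtain rfl : s = t := hef
  have h1 := DrawnEdge.lt_of_power_neg (hD.lt he hs) hp
  have h2 := DrawnEdge.le_of_power_nonpos (hD.lt hf hs) hp'
  rcases (hD.tiling s hs).eq_or_le e he f hf with h | h | h
  · rw [h]
  · have : ((e.2 : ℕ) : ℝ) ≤ ((f.1 : ℕ) : ℝ) := by exact_mod_cast h
    simp only at h1 h2; linarith
  · have : ((f.2 : ℕ) : ℝ) ≤ ((e.1 : ℕ) : ℝ) := by exact_mod_cast h
    simp only at h1 h2; linarith

theorem halfDisc_injOn (hD : D.IsTiled) {e f : DrawnEdge n} (he : e ∈ D) (hf : f ∈ D)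
    (hs : e.1 ≠ Side.spine) (ht : f.1 ≠ Side.spine) (h : e.halfDisc = f.halfDisc) : e = f := by
  have h1 := DrawnEdge.apex_mem hs (hD.lt he hs)
  have h2 := h ▸ h1
  exact hD.eq_of_power_nonpos he hf hs (Side.eq_of_sign_mul_pos h1.2 h2.2.le hs ht) h1.1 h2.1.le

/-! ### The bounded faces -/

theorem halfDisc_subset_compl (hD : D.IsTiled) (hn : 0 < n) {e : DrawnEdge n} (he : e ∈ D)
    (hs : e.1 ≠ Side.spine) : e.halfDisc ⊆ D.supportᶜ := by
  rintro p ⟨hp, hp'⟩ hsup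
  rcases (hD.mem_support hn).1 hsup with ⟨h0, -⟩ | ⟨f, hf, hfs, h1, h2⟩
  · simp [h0] at hp'
  · have := hD.eq_of_power_nonpos he hf hs (Side.eq_of_sign_mul_pos hp' h2 hs hfs) hp h1.le
    subst this
    linarith

theorem connectedComponentIn_halfDisc (hD : D.IsTiled) (hn : 0 < n) {e : DrawnEdge n} (he : e ∈ D)
    (hs : e.1 ≠ Side.spine) {p : ℝ × ℝ} (hp : p ∈ e.halfDisc) :
    connectedComponentIn D.supportᶜ p = e.halfDisc := by
  have hsub := hD.halfDisc_subset_compl hn he hs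
  refine Set.Subset.antisymm ?_ (e.convex_halfDisc.isPreconnected.subset_connectedComponentIn
    hp hsub)
  refine isPreconnected_connectedComponentIn.subset_of_closure_inter_subset e.isOpen_halfDisc
    ⟨p, mem_connectedComponentIn (hsub hp), hp⟩ ?_
  -- A boundary point of the half-disc lies on its semicircle or on the spine.
  rintro q ⟨hq, hq'⟩
  have hq'' := connectedComponentIn_subset _ _ hq'
  obtain ⟨h1, h2⟩ := e.closure_halfDisc_subset hq
  refine ⟨lt_of_le_of_ne h1 fun h => hq'' ?_, lt_of_le_of_ne h2 fun h => hq'' ?_⟩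
  · exact (hD.mem_support hn).2 (Or.inr ⟨e, he, hs, h, h2⟩)
  · have h3 : q.2 = 0 := by
      rcases mul_eq_zero.1 h.symm with h' | h'
      · have := Side.sign_mul_self hs; simp [h'] at this
      · exact h'
    have h4 := DrawnEdge.le_of_power_nonpos (hD.lt he hs) h1
    exact (hD.mem_support hn).2 (Or.inl ⟨h3, (Nat.cast_nonneg _).trans h4.1,
      h4.2.trans (DrawnEdge.vertex_le _)⟩)

end IsTiled

/-- The part of the unbounded face that lies on one closed side of the axis. -/
def exterior (D : Drawing n) (s : Side) : Set (ℝ × ℝ) :=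
  {p | p ∈ D.supportᶜ ∧ 0 ≤ s.sign * p.2 ∧ ∀ e ∈ D, e.1 = s → 0 < e.power p}

theorem arc_subset_frontier {D : Drawing n} {e : DrawnEdge n} (he : e ∈ D)
    {F : Set (ℝ × ℝ)} (hF : F ∈ D.faces) (h : e.arc ⊆ closure F) : e.arc ⊆ frontier F := by
  obtain ⟨p, -, rfl⟩ := hF
  refine fun q hq => ⟨h hq, fun hq' => ?_⟩
  refine connectedComponentIn_subset _ _ (interior_subset hq') ?_
  exact Set.mem_iUnion₂.2 ⟨e, he, hq⟩

namespace IsTiled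

variable {D : Drawing n}

/-- Moving a point away from the axis does not leave the exterior. -/
theorem mem_exterior_of_le (hD : D.IsTiled) (hn : 0 < n) {s : Side} (hs : s ≠ Side.spine)
    {p q : ℝ × ℝ} (hp : 0 ≤ s.sign * p.2) (hpq : p.1 = q.1)
    (hle : s.sign * p.2 < s.sign * q.2) (hpow : ∀ e ∈ D, e.1 = s → 0 ≤ e.power p) :
    q ∈ D.exterior s := by
  have hss := Side.sign_mul_self hs
  have hpos : 0 < s.sign * q.2 := hp.trans_lt hle
  have hq : ∀ e ∈ D, e.1 = s → 0 < e.power q := by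
    intro e he hes
    have h1 := hpow e he hes
    have h2 : p.2 ^ 2 < q.2 ^ 2 := by
      have h3 : (s.sign * p.2) ^ 2 < (s.sign * q.2) ^ 2 := by gcongr
      have h4 : ∀ y : ℝ, (s.sign * y) ^ 2 = y ^ 2 := fun y => by
        rw [mul_pow, sq s.sign, hss, one_mul]
      rwa [h4, h4] at h3
    unfold DrawnEdge.power at h1 ⊢
    rw [← hpq]
    linarith
  refine ⟨fun hsup => ?_, hpos.le, hq⟩
  rcases (hD.mem_support hn).1 hsup with ⟨h0, -⟩ | ⟨f, hf, hfs, h1, h2⟩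
  · simp [h0] at hpos
  · have := hq f hf (Side.eq_of_sign_mul_pos hpos h2 hs hfs).symm
    linarith

theorem halfPlane_subset_exterior (hD : D.IsTiled) (hn : 0 < n) {s : Side} (hs : s ≠ Side.spine) :
    {p : ℝ × ℝ | (n : ℝ) < s.sign * p.2} ⊆ D.exterior s := by
  intro p hp
  have hss := Side.sign_mul_self hs
  have hp' : (n : ℝ) < s.sign * p.2 := hp
  refine hD.mem_exterior_of_le hn hs (p := (p.1, s.sign * n)) ?_ rfl ?_ ?_
  · simp [← mul_assoc, hss]
  · simpa [← mul_assoc, hss] using hp'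
  · intro e he hes
    have h1 := DrawnEdge.vertex_le e.2.1
    have h2 := DrawnEdge.vertex_le e.2.2
    have h3 : (0 : ℝ) ≤ ((e.2.1 : ℕ) : ℝ) := Nat.cast_nonneg _
    have h4 : (0 : ℝ) ≤ ((e.2.2 : ℕ) : ℝ) := Nat.cast_nonneg _
    have h5 : (s.sign * (n : ℝ)) ^ 2 = (n : ℝ) ^ 2 := by rw [mul_pow, sq s.sign, hss, one_mul]
    simp only [DrawnEdge.power, h5]
    nlinarith [sq_nonneg (p.1 - (((e.2.1 : ℕ) : ℝ) + ((e.2.2 : ℕ) : ℝ)) / 2)]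

/-- Every point of the exterior can be joined to a far half-plane by a vertical ray. -/
theorem isPreconnected_exterior (hD : D.IsTiled) (hn : 0 < n) {s : Side} (hs : s ≠ Side.spine) :
    IsPreconnected (D.exterior s) := by
  have hss := Side.sign_mul_self hs
  have hhalf := hD.halfPlane_subset_exterior hn hs
  refine isPreconnected_of_forall ((0 : ℝ), s.sign * ((n : ℝ) + 1)) fun p hp => ?_
  refine ⟨{q | p.1 = q.1 ∧ s.sign * p.2 ≤ s.sign * q.2} ∪ {q | (n : ℝ) < s.sign * q.2},
    Set.union_subset ?_ hhalf, Or.inr ?_, Or.inl ⟨rfl, le_rfl⟩, ?_⟩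
  · rintro q ⟨h1, h2⟩
    rcases h2.lt_or_eq with h | h
    · exact hD.mem_exterior_of_le hn hs hp.2.1 h1 h fun e he hes => (hp.2.2 e he hes).le
    · have : p.2 = q.2 := by
        have := congrArg (s.sign * ·) h
        simpa [← mul_assoc, hss] using this
      rwa [show q = p from Prod.ext h1.symm this.symm]
  · simp [← mul_assoc, hss]
  · refine IsPreconnected.union (p.1, s.sign * (s.sign * p.2 + n + 1)) ⟨rfl, ?_⟩ ?_ ?_ ?_
    · simp only [← mul_assoc s.sign s.sign, hss]
      linarith [(Nat.cast_nonneg n : (0 : ℝ) ≤ n)]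
    · simp only [Set.mem_ofPred_eq, ← mul_assoc s.sign s.sign, hss]
      linarith [hp.2.1]
    · refine Convex.isPreconnected ?_
      rintro x ⟨hx1, hx2⟩ y ⟨hy1, hy2⟩ a b ha hb hab
      constructor
      · simp only [Prod.fst_add, Prod.smul_fst, smul_eq_mul, ← hx1, ← hy1]
        rw [← add_mul, hab, one_mul]
      · simp only [Prod.snd_add, Prod.smul_snd, smul_eq_mul]
        obtain rfl : a = 1 - b := by linarith
        nlinarith
    · refine Convex.isPreconnected ?_
      intro x hx y hy a b ha hb hab
      simp only [Set.mem_ofPred_eq, Prod.snd_add, Prod.smul_snd, smul_eq_mul] at hx hy ⊢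
      obtain rfl : a = 1 - b := by linarith
      rcases hb.eq_or_lt with rfl | hb
      · linarith
      · nlinarith [mul_lt_mul_of_pos_left hy hb, mul_le_mul_of_nonneg_left hx.le ha]

theorem exterior_subset_component (hD : D.IsTiled) (hn : 0 < n) {s : Side} (hs : s ≠ Side.spine)
    {p : ℝ × ℝ} (hp : p ∈ D.exterior s) :
    D.exterior s ⊆ connectedComponentIn D.supportᶜ p :=
  (hD.isPreconnected_exterior hn hs).subset_connectedComponentIn hp fun _ hq => hq.1

theorem not_isBounded_component (hD : D.IsTiled) (hn : 0 < n) {s : Side} (hs : s ≠ Side.spine)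
    {p : ℝ × ℝ} (hp : p ∈ D.exterior s) :
    ¬ Bornology.IsBounded (connectedComponentIn D.supportᶜ p) := by
  intro hb
  have hss := Side.sign_mul_self hs
  obtain ⟨R, hR⟩ := (hb.subset ((hD.halfPlane_subset_exterior hn hs).trans
    (hD.exterior_subset_component hn hs hp))).exists_norm_le
  have h1 := hR ((0 : ℝ), s.sign * (n + |R| + 1)) (by
    simp only [Set.mem_ofPred_eq, ← mul_assoc s.sign s.sign, hss]
    linarith [abs_nonneg R])
  have h2 : |s.sign * (n + |R| + 1)| ≤ R := (le_max_right _ _).trans h1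
  have h3 := le_abs_self R
  have h4 : |s.sign| = 1 := by
    have := abs_mul_abs_self s.sign
    rw [hss] at this
    nlinarith [abs_nonneg s.sign]
  rw [abs_mul, h4, one_mul, abs_of_nonneg (by positivity)] at h2
  linarith [(Nat.cast_nonneg n : (0 : ℝ) ≤ n)]

theorem exists_mem_halfDisc_or_mem_exterior (hD : D.IsTiled) (hn : 0 < n) {p : ℝ × ℝ}
    (hp : p ∈ D.supportᶜ) : (∃ e ∈ D, e.1 ≠ Side.spine ∧ p ∈ e.halfDisc) ∨
      ∃ s ≠ Side.spine, p ∈ D.exterior s := by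
  by_contra! h
  obtain ⟨h1, h2⟩ := h
  obtain ⟨s, hs, hsp⟩ : ∃ s, s ≠ Side.spine ∧ 0 ≤ s.sign * p.2 := by
    rcases le_total 0 p.2 with h | h
    · exact ⟨Side.above, by simp, by simpa [Side.sign] using h⟩
    · exact ⟨Side.below, by simp, by simpa [Side.sign] using h⟩
  refine h2 s hs ⟨hp, hsp, fun e he hes => ?_⟩
  subst hes
  by_contra! hpow
  rcases hpow.lt_or_eq with h3 | h3
  · rcases hsp.lt_or_eq with h4 | h4
    · exact h1 e he hs ⟨h3, h4⟩
    · have h5 : p.2 = 0 := by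
        rcases mul_eq_zero.1 h4.symm with h' | h'
        · have := Side.sign_mul_self hs; simp [h'] at this
        · exact h'
      have h6 := DrawnEdge.le_of_power_nonpos (hD.lt he hs) hpow
      exact hp ((hD.mem_support hn).2 (Or.inl ⟨h5, (Nat.cast_nonneg _).trans h6.1,
        h6.2.trans (DrawnEdge.vertex_le _)⟩))
  · exact hp ((hD.mem_support hn).2 (Or.inr ⟨e, he, hs, h3, hsp⟩))

theorem halfDisc_mem_faces (hD : D.IsTiled) (hn : 0 < n) {e : DrawnEdge n} (he : e ∈ D)
    (hs : e.1 ≠ Side.spine) : e.halfDisc ∈ D.faces := by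
  have h := DrawnEdge.apex_mem hs (hD.lt he hs)
  exact ⟨e.apex, hD.halfDisc_subset_compl hn he hs h,
    (hD.connectedComponentIn_halfDisc hn he hs h).symm⟩

theorem mem_boundedFaces (hD : D.IsTiled) (hn : 0 < n) {F : Set (ℝ × ℝ)} :
    F ∈ D.boundedFaces ↔ ∃ e ∈ D, e.1 ≠ Side.spine ∧ e.halfDisc = F := by
  constructor
  · rintro ⟨⟨p, hp, rfl⟩, hb⟩
    rcases hD.exists_mem_halfDisc_or_mem_exterior hn hp with ⟨e, he, hs, hpe⟩ | ⟨s, hs, hps⟩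
    · exact ⟨e, he, hs, (hD.connectedComponentIn_halfDisc hn he hs hpe).symm⟩
    · exact absurd hb (hD.not_isBounded_component hn hs hps)
  · rintro ⟨e, he, hs, rfl⟩
    exact ⟨hD.halfDisc_mem_faces hn he hs, DrawnEdge.isBounded_halfDisc (hD.lt he hs)⟩

/-! ### The dual edges -/

/-- A semicircle borders the unbounded face, hence contributes no edge to the truncated dual. -/
theorem exists_unbounded_incident (hD : D.IsTiled) (hn : 0 < n) {e : DrawnEdge n} (he : e ∈ D)
    (hs : e.1 ≠ Side.spine) : ∃ F ∈ D.incidentFaces e, ¬ Bornology.IsBounded F := by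
  have hss := Side.sign_mul_self hs
  have hp := hD.halfPlane_subset_exterior hn hs
    (a := ((0 : ℝ), e.1.sign * ((n : ℝ) + 1))) (by simp [← mul_assoc, hss])
  have hF : connectedComponentIn D.supportᶜ ((0 : ℝ), e.1.sign * ((n : ℝ) + 1)) ∈ D.faces :=
    ⟨_, hp.1, rfl⟩
  refine ⟨_, ⟨hF, arc_subset_frontier he hF fun q hq => ?_⟩,
    hD.not_isBounded_component hn hs hp⟩
  refine closure_mono (hD.exterior_subset_component hn hs hp) ?_
  obtain ⟨hq1, hq2⟩ := (DrawnEdge.mem_arc hs).1 hq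
  have hlim : Filter.Tendsto (fun t : ℝ => (q.1, q.2 + e.1.sign * t)) (nhdsWithin 0 (Set.Ioi 0))
      (nhds q) := by
    have : Continuous (fun t : ℝ => (q.1, q.2 + e.1.sign * t)) := by fun_prop
    simpa using (this.tendsto 0).mono_left nhdsWithin_le_nhds
  refine mem_closure_of_tendsto hlim ?_
  filter_upwards [self_mem_nhdsWithin] with t ht
  refine hD.mem_exterior_of_le hn hs hq2 rfl ?_ fun f hf hfs => ?_
  · simp only [mul_add, ← mul_assoc, hss]
    linarith [Set.mem_Ioi.1 ht]
  · by_contra! hneg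
    have := hD.eq_of_power_nonpos hf he (hfs ▸ hs) hfs hneg hq1.le
    subst this
    linarith

theorem power_neg_of_cover {e : DrawnEdge n} {k : ℕ} (h1 : (e.2.1 : ℕ) ≤ k)
    (h2 : k < (e.2.2 : ℕ)) : e.power ((k : ℝ) + 1 / 2, 0) < 0 := by
  have h1' : ((e.2.1 : ℕ) : ℝ) ≤ k := by exact_mod_cast h1
  have h2' : (k : ℝ) + 1 ≤ ((e.2.2 : ℕ) : ℝ) := by exact_mod_cast h2
  simp only [DrawnEdge.power]
  nlinarith

theorem spine_arc_subset_frontier (hD : D.IsTiled) (hn : 0 < n) {e c : DrawnEdge n} (he : e ∈ D)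
    (hs : e.1 ≠ Side.spine) (hc : c ∈ D) (hcs : c.1 = Side.spine) (h1 : e.2.1 ≤ c.2.1)
    (h2 : c.2.2 ≤ e.2.2) : e.halfDisc ∈ D.incidentFaces c := by
  have hF := hD.halfDisc_mem_faces hn he hs
  refine ⟨hF, arc_subset_frontier hc hF fun q hq => ?_⟩
  obtain ⟨s, i, j⟩ := c
  obtain rfl : s = Side.spine := hcs
  obtain ⟨hq1, hq2, hq3⟩ := hq
  have h1' : ((e.2.1 : ℕ) : ℝ) ≤ ((i : ℕ) : ℝ) := by exact_mod_cast h1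
  have h2' : ((j : ℕ) : ℝ) ≤ ((e.2.2 : ℕ) : ℝ) := by exact_mod_cast h2
  refine DrawnEdge.mem_closure_halfDisc hs (hD.lt he hs) ?_ (by simp [hq3])
  simp only [DrawnEdge.power, hq3]
  nlinarith

/-- The faces at a spine edge are the half-discs of the two tiles that cover it. -/
theorem incidentFaces_spine (hD : D.IsTiled) (hn : 0 < n) {a b c : DrawnEdge n} (ha : a ∈ D)
    (hb : b ∈ D) (hc : c ∈ D) (has : a.1 = Side.below) (hbs : b.1 = Side.above)
    (hcs : c.1 = Side.spine) (ha1 : a.2.1 ≤ c.2.1) (ha2 : c.2.2 ≤ a.2.2) (hb1 : b.2.1 ≤ c.2.1)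
    (hb2 : c.2.2 ≤ b.2.2) : D.incidentFaces c = {a.halfDisc, b.halfDisc} := by
  have has' : a.1 ≠ Side.spine := by simp [has]
  have hbs' : b.1 ≠ Side.spine := by simp [hbs]
  refine Set.Subset.antisymm ?_ ?_
  · rintro F ⟨⟨p, hp, rfl⟩, hF⟩
    have hlen : (c.2.2 : ℕ) = (c.2.1 : ℕ) + 1 := by
      have : c.2 ∈ D.sideEdges Side.spine := by rw [← hcs]; exact hc
      rwa [hD.spine] at this
    -- Near the midpoint of the spine edge only the two half-discs and the axis are found.
    have hmid : ((((c.2.1 : ℕ) : ℝ) + 1 / 2, 0) : ℝ × ℝ) ∈ c.arc := by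
      obtain ⟨s, i, j⟩ := c
      obtain rfl : s = Side.spine := hcs
      simp only at hlen
      simp only [DrawnEdge.arc, Set.mem_ofPred_eq, hlen]
      push_cast
      exact ⟨by linarith, by linarith, trivial⟩
    have hcl := frontier_subset_closure (hF hmid)
    have hopen : IsOpen {q : ℝ × ℝ | a.power q < 0 ∧ b.power q < 0} :=
      (isOpen_lt a.continuous_power continuous_const).inter
        (isOpen_lt b.continuous_power continuous_const)
    obtain ⟨q, ⟨hqa, hqb⟩, hq⟩ := mem_closure_iff.1 hcl _ hopen
      ⟨power_neg_of_cover ha1 (by have : (c.2.2 : ℕ) ≤ a.2.2 := ha2; omega),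
        power_neg_of_cover hb1 (by have : (c.2.2 : ℕ) ≤ b.2.2 := hb2; omega)⟩
    have hqU := connectedComponentIn_subset _ _ hq
    rw [connectedComponentIn_eq hq]
    rcases lt_trichotomy q.2 0 with h | h | h
    · exact Or.inl (hD.connectedComponentIn_halfDisc hn ha has'
        ⟨hqa, by simpa [has, Side.sign] using h⟩)
    · have h4 := DrawnEdge.lt_of_power_neg (hD.lt ha has') hqa
      exact absurd ((hD.mem_support hn).2 (Or.inl ⟨h, (Nat.cast_nonneg _).trans h4.1.le,
        h4.2.le.trans (DrawnEdge.vertex_le _)⟩)) hqU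
    · exact Or.inr (hD.connectedComponentIn_halfDisc hn hb hbs'
        ⟨hqb, by simpa [hbs, Side.sign] using h⟩)
  · rintro F (rfl | rfl)
    · exact hD.spine_arc_subset_frontier hn ha has' hc hcs ha1 ha2
    · exact hD.spine_arc_subset_frontier hn hb hbs' hc hcs hb1 hb2

/-- The dual edges between two bounded faces are the spine edges covered by a tile below and a
tile above whose half-discs are these two faces. -/
theorem mem_dualEdges (hD : D.IsTiled) (hn : 0 < n) {F F' : Set (ℝ × ℝ)}
    (hF : F ∈ D.boundedFaces) (hF' : F' ∈ D.boundedFaces) {c : DrawnEdge n} :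
    c ∈ D.dualEdges F F' ↔ c ∈ D ∧ c.1 = Side.spine ∧ ∃ a ∈ D, ∃ b ∈ D, a.1 = Side.below ∧
      b.1 = Side.above ∧ (a.2.1 ≤ c.2.1 ∧ c.2.2 ≤ a.2.2) ∧ (b.2.1 ≤ c.2.1 ∧ c.2.2 ≤ b.2.2) ∧
      ({a.halfDisc, b.halfDisc} : Set (Set (ℝ × ℝ))) = {F, F'} := by
  constructor
  · rintro ⟨hc, hinc⟩
    have hcs : c.1 = Side.spine := by
      by_contra hcs
      obtain ⟨F₀, hF₀, hb⟩ := hD.exists_unbounded_incident hn hc hcs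
      rw [hinc] at hF₀
      rcases hF₀ with rfl | rfl
      · exact hb hF.2
      · exact hb hF'.2
    have hlen : (c.2.2 : ℕ) = (c.2.1 : ℕ) + 1 := by
      have : c.2 ∈ D.sideEdges Side.spine := by rw [← hcs]; exact hc
      rwa [hD.spine] at this
    have hk : (c.2.1 : ℕ) < n := by have := c.2.2.2; omega
    obtain ⟨a, ha, ha1, ha2⟩ := (hD.tiling Side.below (by simp)).cover _ hk
    obtain ⟨b, hb, hb1, hb2⟩ := (hD.tiling Side.above (by simp)).cover _ hk
    have ha2' : c.2.2 ≤ a.2 := by rw [Fin.le_def]; omega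
    have hb2' : c.2.2 ≤ b.2 := by rw [Fin.le_def]; omega
    refine ⟨hc, hcs, (Side.below, a), ha, (Side.above, b), hb, rfl, rfl, ⟨ha1, ha2'⟩,
      ⟨hb1, hb2'⟩, ?_⟩
    rw [← hinc, hD.incidentFaces_spine (a := (Side.below, a)) (b := (Side.above, b)) hn ha hb hc
      rfl rfl hcs ha1 ha2' hb1 hb2']
  · rintro ⟨hc, hcs, a, ha, b, hb, has, hbs, ⟨ha1, ha2⟩, ⟨hb1, hb2⟩, h⟩
    exact ⟨hc, by rw [← h, hD.incidentFaces_spine hn ha hb hc has hbs hcs ha1 ha2 hb1 hb2]⟩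

end IsTiled

end Drawing

/-! ### Paths as sets of consecutive vertices -/

/-- The pairs of consecutive elements of a finite set of a linear order. -/
def consecutivePairs {α : Type*} [LinearOrder α] (V : Finset α) : Set (α × α) :=
  {e | e.1 ∈ V ∧ e.2 ∈ V ∧ e.1 < e.2 ∧ ∀ c ∈ V, c ≤ e.1 ∨ e.2 ≤ c}

theorem List.mem_zip_tail_iff_of_pairwise_lt {α : Type*} [LinearOrder α] {l : List α}
    (hl : l.Pairwise (· < ·)) (e : α × α) :
    e ∈ l.zip l.tail ↔ e.1 ∈ l ∧ e.2 ∈ l ∧ e.1 < e.2 ∧ ∀ c ∈ l, c ≤ e.1 ∨ e.2 ≤ c := by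
  obtain ⟨x, y⟩ := e
  induction l with
  | nil => simp
  | cons a t ih =>
    cases t with
    | nil =>
      simp only [List.tail_cons, List.zip_nil_right, List.not_mem_nil, List.mem_singleton,
        false_iff]
      rintro ⟨rfl, rfl, h, -⟩
      exact lt_irrefl _ h
    | cons b t =>
      obtain ⟨ha, ht⟩ := List.pairwise_cons.1 hl
      have ih := ih ht
      have hb : ∀ c ∈ b :: t, b ≤ c := by
        intro c hc
        rcases List.mem_cons.1 hc with rfl | hc
        · exact le_rfl
        · exact ((List.pairwise_cons.1 ht).1 c hc).le
      have hz : (a :: b :: t).zip (a :: b :: t).tail = (a, b) :: (b :: t).zip (b :: t).tail := rfl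
      rw [hz, List.mem_cons, ih, Prod.mk.injEq]
      simp only
      constructor
      · rintro (⟨rfl, rfl⟩ | ⟨h1, h2, h3, h4⟩)
        · refine ⟨by simp, by simp, ha _ (by simp), fun c hc => ?_⟩
          rcases List.mem_cons.1 hc with rfl | hc
          · exact Or.inl le_rfl
          · exact Or.inr (hb c hc)
        · refine ⟨List.mem_cons_of_mem _ h1, List.mem_cons_of_mem _ h2, h3, fun c hc => ?_⟩
          rcases List.mem_cons.1 hc with rfl | hc
          · exact Or.inl (ha _ h1).le
          · exact h4 c hc
      · rintro ⟨h1, h2, h3, h4⟩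
        have hx : a ≤ x := by
          rcases List.mem_cons.1 h1 with rfl | h1
          · exact le_rfl
          · exact (ha _ h1).le
        have hy : y ∈ b :: t := (List.mem_cons.1 h2).resolve_left (hx.trans_lt h3).ne'
        rcases List.mem_cons.1 h1 with rfl | h1
        · refine Or.inl ⟨rfl, ?_⟩
          rcases h4 b (by simp) with h | h
          · exact absurd h (not_le.2 (ha b (by simp)))
          · exact le_antisymm h (hb y hy)
        · exact Or.inr ⟨h1, hy, h3, fun c hc => h4 c (List.mem_cons_of_mem _ hc)⟩

/-- A path from the first to the last vertex is determined by the vertices that it visits. -/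
theorem isSourceSinkPath_iff {n : ℕ} {P : Set (Fin (n + 1) × Fin (n + 1))} :
    IsSourceSinkPath P ↔ ∃ V : Finset (Fin (n + 1)),
      0 ∈ V ∧ Fin.last n ∈ V ∧ P = consecutivePairs V := by
  constructor
  · rintro ⟨p, h0, hlast, hp, rfl⟩
    refine ⟨p.toFinset, ?_, ?_, ?_⟩
    · simpa using List.mem_of_head? h0
    · simpa using List.mem_of_getLast? hlast
    · ext e
      simpa [consecutivePairs] using List.mem_zip_tail_iff_of_pairwise_lt hp.pairwise e
  · rintro ⟨V, h0, hlast, rfl⟩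
    have hp : (V.sort).Pairwise (· < ·) := V.sortedLT_sort.pairwise
    have hm : ∀ v, v ∈ V.sort ↔ v ∈ V := fun v => V.mem_sort (· ≤ ·)
    refine ⟨V.sort, ?_, ?_, hp.isChain, ?_⟩
    · have h := (hm 0).2 h0
      cases hl : V.sort with
      | nil => simp [hl] at h
      | cons a t =>
        rw [hl] at h hp
        rcases List.mem_cons.1 h with rfl | h
        · rfl
        · exact absurd ((List.pairwise_cons.1 hp).1 _ h) (Fin.not_lt_zero a)
    · have h := (hm _).2 hlast
      rcases List.eq_nil_or_concat V.sort with hl | ⟨t, a, hl⟩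
      · simp [hl] at h
      · rw [List.concat_eq_append] at hl
        rw [hl] at h hp
        rw [hl]
        simp only [List.mem_append, List.mem_singleton] at h
        rcases h with h | rfl
        · exact absurd ((List.pairwise_append.1 hp).2.2 _ h a (by simp)) (Fin.le_last a).not_gt
        · simp
    · ext e
      simpa [consecutivePairs, hm] using (List.mem_zip_tail_iff_of_pairwise_lt hp e).symm

section Consecutive

variable {n : ℕ} {V : Finset (Fin (n + 1))}

theorem exists_consecutivePairs_snd (hlast : Fin.last n ∈ V) {i : Fin (n + 1)} (hi : i ∈ V)
    (hin : i ≠ Fin.last n) : ∃ j, (i, j) ∈ consecutivePairs V := by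
  have hne : (V.filter (i < ·)).Nonempty :=
    ⟨Fin.last n, Finset.mem_filter.2 ⟨hlast, Fin.lt_last_iff_ne_last.2 hin⟩⟩
  obtain ⟨h1, h2⟩ := Finset.mem_filter.1 ((V.filter (i < ·)).min'_mem hne)
  refine ⟨_, hi, h1, h2, fun c hc => ?_⟩
  rcases le_or_gt c i with h | h
  · exact Or.inl h
  · exact Or.inr (Finset.min'_le _ _ (Finset.mem_filter.2 ⟨hc, h⟩))

theorem exists_consecutivePairs_fst (h0 : 0 ∈ V) {j : Fin (n + 1)} (hj : j ∈ V)
    (hj0 : j ≠ 0) : ∃ i, (i, j) ∈ consecutivePairs V := by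
  have hne : (V.filter (· < j)).Nonempty :=
    ⟨0, Finset.mem_filter.2 ⟨h0, Fin.pos_iff_ne_zero.2 hj0⟩⟩
  obtain ⟨h1, h2⟩ := Finset.mem_filter.1 ((V.filter (· < j)).max'_mem hne)
  refine ⟨_, h1, hj, h2, fun c hc => ?_⟩
  rcases lt_or_ge c j with h | h
  · exact Or.inl (Finset.le_max' _ _ (Finset.mem_filter.2 ⟨hc, h⟩))
  · exact Or.inr h

theorem consecutivePairs_eq_or_le {α : Type*} [LinearOrder α] {V : Finset α} {e f : α × α}
    (he : e ∈ consecutivePairs V) (hf : f ∈ consecutivePairs V) :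
    e = f ∨ e.2 ≤ f.1 ∨ f.2 ≤ e.1 := by
  obtain ⟨e1, e2, elt, e3⟩ := he
  obtain ⟨f1, f2, flt, f3⟩ := hf
  rcases e3 f.1 f1 with h1 | h1
  · rcases f3 e.1 e1 with h2 | h2
    · rcases e3 f.2 f2 with h3 | h3
      · exact Or.inr (Or.inr h3)
      · rcases f3 e.2 e2 with h4 | h4
        · exact Or.inr (Or.inl h4)
        · exact Or.inl (Prod.ext (le_antisymm h2 h1) (le_antisymm h3 h4))
    · exact Or.inr (Or.inr h2)
  · exact Or.inr (Or.inl h1)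

theorem isTiling_consecutivePairs (h0 : 0 ∈ V) (hlast : Fin.last n ∈ V) :
    IsTiling (consecutivePairs V) where
  lt := fun _ he => he.2.2.1
  eq_or_le := fun _ he _ hf => consecutivePairs_eq_or_le he hf
  cover := by
    intro k hk
    have hne : (V.filter (fun v : Fin (n + 1) => (v : ℕ) ≤ k)).Nonempty :=
      ⟨0, Finset.mem_filter.2 ⟨h0, by simp⟩⟩
    obtain ⟨h1, h2⟩ := Finset.mem_filter.1
      ((V.filter (fun v : Fin (n + 1) => (v : ℕ) ≤ k)).max'_mem hne)
    obtain ⟨j, hj⟩ := exists_consecutivePairs_snd hlast h1 (by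
      intro h; rw [h] at h2; simp at h2; omega)
    refine ⟨_, hj, h2, ?_⟩
    by_contra! h
    exact absurd hj.2.2.1 (not_lt.2 (Finset.le_max' _ _ (Finset.mem_filter.2 ⟨hj.2.1, h⟩)))

end Consecutive

theorem Drawing.IsConventional.isTiled {n : ℕ} {D : Drawing n} {G : DAG n}
    (h : D.IsConventional G) : D.IsTiled where
  spine := h.2.1
  tiling := by
    have key : ∀ P : Set (Fin (n + 1) × Fin (n + 1)), IsSourceSinkPath P → IsTiling P := by
      intro P hP
      obtain ⟨V, h0, hlast, rfl⟩ := isSourceSinkPath_iff.1 hP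
      exact isTiling_consecutivePairs h0 hlast
    intro s hs
    cases s
    · exact absurd rfl hs
    · exact key _ h.2.2.1
    · exact key _ h.2.2.2.2

/-- The tree of a conventional drawing has a leaf as its left-most rank-0 vertex: the left-most
face below the spine is the half-disc of the edge from the first to the second vertex, so it has a single
spine edge on its boundary. -/
theorem RankedNoncrossingTree.IsTruncatedDualOf.leftmostHasDegreeOne {l r n : ℕ}
    {T : RankedNoncrossingTree l r} {D : Drawing n} {G : DAG n} (hn : 0 < n)
    (hT : T.IsTruncatedDualOf D) (hDG : D.IsConventional G) : T.LeftmostHasDegreeOne := by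
  have hD := hDG.isTiled
  obtain ⟨φ, hbelow, habove, hleft, -, hadj, hnadj⟩ := hT
  have h1v : (((1 : Fin (n + 1)) : ℕ)) = 1 := by
    rw [Fin.val_one', Nat.mod_eq_of_lt (by omega)]
  have he₀ : ((Side.below, 0, 1) : DrawnEdge n) ∈ D := hDG.2.2.2.1
  set e₀ : DrawnEdge n := (Side.below, 0, 1) with he₀def
  have he₀s : e₀.1 ≠ Side.spine := by simp [he₀def]
  have hapex₀ := DrawnEdge.apex_mem he₀s (hD.lt he₀ he₀s)
  -- The half-disc of the tile from `0` to `1` is the left-most face below the spine.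
  have hF₀ : e₀.halfDisc ∈ D.boundedFaces := (hD.mem_boundedFaces hn).2 ⟨e₀, he₀, he₀s, rfl⟩
  obtain ⟨i₀, hi₀⟩ : ∃ i₀ : Fin l, (φ (Sum.inl i₀) : Set (ℝ × ℝ)) = e₀.halfDisc := by
    obtain ⟨u, hu⟩ := φ.surjective ⟨_, hF₀⟩
    have hu' : (φ u : Set (ℝ × ℝ)) = e₀.halfDisc := by rw [hu]
    cases u with
    | inl i => exact ⟨i, hu'⟩
    | inr j =>
      have h1 : 0 < e₀.apex.2 := habove j (hu' ▸ hapex₀)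
      have h2 : 0 < Side.below.sign * e₀.apex.2 := hapex₀.2
      simp only [Side.sign] at h2
      linarith
  have hl : 0 < l := i₀.pos
  have hzero : (φ (Sum.inl ⟨0, hl⟩) : Set (ℝ × ℝ)) = e₀.halfDisc := by
    rcases (Nat.zero_le (i₀ : ℕ)).eq_or_lt with h | h
    · rw [← hi₀]; congr 3; exact Fin.ext h
    · exfalso
      obtain ⟨e, he, hes, heF⟩ := (hD.mem_boundedFaces hn).1 (φ (Sum.inl ⟨0, hl⟩)).2
      have hapex := DrawnEdge.apex_mem hes (hD.lt he hes)
      have hlt := hleft ⟨0, hl⟩ i₀ h _ (heF ▸ hapex) _ (hi₀ ▸ hapex₀)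
      have h2 : 1 ≤ (e.2.2 : ℕ) := by
        have := hD.lt he hes; rw [Fin.lt_def] at this; omega
      have h3 : (1 : ℝ) ≤ ((e.2.2 : ℕ) : ℝ) := by exact_mod_cast h2
      have h4 : (0 : ℝ) ≤ ((e.2.1 : ℕ) : ℝ) := Nat.cast_nonneg _
      simp only [DrawnEdge.apex, he₀def, h1v] at hlt
      simp at hlt
      linarith
  -- `b₀` is the only tile above that shares a spine edge with the tile from `0` to `1`.
  obtain ⟨b₀, hb₀, hb₀1, hb₀2⟩ := (hD.tiling Side.above (by simp)).cover 0 hn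
  have hb₀' : ((Side.above, b₀) : DrawnEdge n) ∈ D := hb₀
  have hB₀ : DrawnEdge.halfDisc (Side.above, b₀) ∈ D.boundedFaces :=
    (hD.mem_boundedFaces hn).2 ⟨_, hb₀', by simp, rfl⟩
  obtain ⟨v₀, hv₀⟩ := φ.surjective ⟨_, hB₀⟩
  have hv₀' : (φ v₀ : Set (ℝ × ℝ)) = DrawnEdge.halfDisc (Side.above, b₀) := by rw [hv₀]
  have hc₀ : ((Side.spine, 0, 1) : DrawnEdge n) ∈ D := by
    have : ((0, 1) : Fin (n + 1) × Fin (n + 1)) ∈ D.sideEdges Side.spine := by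
      rw [hD.spine]; exact h1v
    exact this
  refine ⟨hl, Set.ncard_eq_one.2 ⟨v₀, ?_⟩⟩
  ext v
  rw [SimpleGraph.mem_neighborSet, Set.mem_singleton_iff]
  constructor
  · intro h
    obtain ⟨c, hc⟩ : (D.dualEdges (φ (Sum.inl ⟨0, hl⟩)) (φ v)).Nonempty :=
      Set.nonempty_of_ncard_ne_zero (by rw [hadj _ _ h]; simp)
    obtain ⟨hcD, hcs, a, ha, b, hb, has, hbs, ⟨ha1, ha2⟩, ⟨hb1, hb2⟩, heq⟩ :=
      (hD.mem_dualEdges hn (φ _).2 (φ _).2).1 hc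
    rw [hzero] at heq
    have has' : a.1 ≠ Side.spine := by simp [has]
    have hbs' : b.1 ≠ Side.spine := by simp [hbs]
    have hbe : b.halfDisc ≠ e₀.halfDisc := by
      intro h
      have := congrArg Prod.fst (hD.halfDisc_injOn hb he₀ hbs' he₀s h)
      rw [hbs] at this
      simp [he₀def] at this
    have hae : a.halfDisc = e₀.halfDisc ∧ b.halfDisc = φ v := by
      have h1 : e₀.halfDisc ∈ ({a.halfDisc, b.halfDisc} : Set (Set (ℝ × ℝ))) := by
        rw [heq]; exact Or.inl rfl
      have h2 : b.halfDisc ∈ ({e₀.halfDisc, (φ v : Set (ℝ × ℝ))} : Set (Set (ℝ × ℝ))) := by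
        rw [← heq]; exact Or.inr rfl
      exact ⟨(h1.resolve_right hbe.symm).symm, h2.resolve_left hbe⟩
    have hae' := hD.halfDisc_injOn ha he₀ has' he₀s hae.1
    subst hae'
    have hb₀b : b = (Side.above, b₀) := by
      have hb' : b.2 ∈ D.sideEdges Side.above := by rw [← hbs]; exact hb
      have hclt : c.2.1 < c.2.2 := by
        have : c.2 ∈ D.sideEdges Side.spine := by rw [← hcs]; exact hcD
        rw [hD.spine] at this
        rw [Fin.lt_def]; exact (Nat.lt_succ_self _).trans_eq this.symm
      have hc0 : c.2.2 ≤ 1 := ha2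
      rw [Fin.le_def, h1v] at hc0
      rw [Fin.lt_def] at hclt
      rw [Fin.le_def] at hb1 hb2
      rcases (hD.tiling Side.above (by simp)).eq_or_le _ hb' _ hb₀ with h | h | h
      · exact Prod.ext hbs h
      · rw [Fin.le_def] at h; omega
      · rw [Fin.le_def] at h; omega
    refine φ.injective (Subtype.ext ?_)
    rw [hv₀', ← hae.2, hb₀b]
  · rintro rfl
    by_contra hna
    have : ((Side.spine, 0, 1) : DrawnEdge n) ∈ D.dualEdges (φ (Sum.inl ⟨0, hl⟩)) (φ v) := by
      refine (hD.mem_dualEdges hn (φ _).2 (φ _).2).2 ⟨hc₀, rfl, e₀, he₀, (Side.above, b₀), hb₀',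
        rfl, rfl, ⟨le_rfl, le_rfl⟩, ⟨?_, ?_⟩, by rw [hzero, hv₀']⟩
      · exact Fin.le_def.2 hb₀1
      · rw [Fin.le_def, h1v]; exact hb₀2
    rw [hnadj _ _ hna] at this
    exact this

/-! ### Bipartite non-crossing trees as staircases -/

section BipartiteGraph

variable {l r : ℕ} {E : Finset (Fin l × Fin r)}

theorem bipartiteGraph_adj_inl_inr {i : Fin l} {j : Fin r} :
    (bipartiteGraph E).Adj (Sum.inl i) (Sum.inr j) ↔ (i, j) ∈ E := by
  simp [bipartiteGraph, SimpleGraph.fromRel_adj]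

theorem bipartiteGraph_not_adj_inl_inl {i j : Fin l} :
    ¬ (bipartiteGraph E).Adj (Sum.inl i) (Sum.inl j) := by
  simp [bipartiteGraph, SimpleGraph.fromRel_adj]

theorem bipartiteGraph_not_adj_inr_inr {i j : Fin r} :
    ¬ (bipartiteGraph E).Adj (Sum.inr i) (Sum.inr j) := by
  simp [bipartiteGraph, SimpleGraph.fromRel_adj]

theorem card_edgeSet_bipartiteGraph : Nat.card (bipartiteGraph E).edgeSet = E.card := by
  have himg : (bipartiteGraph E).edgeSet =
      (fun e : Fin l × Fin r => s(Sum.inl e.1, Sum.inr e.2)) '' (E : Set (Fin l × Fin r)) := by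
    ext e
    induction e with | _ u v => ?_
    rw [SimpleGraph.mem_edgeSet]
    rcases u with i | i <;> rcases v with j | j
    · simp [bipartiteGraph_not_adj_inl_inl]
    · simp [bipartiteGraph_adj_inl_inr]
    · rw [SimpleGraph.adj_comm]; simp [bipartiteGraph_adj_inl_inr]
    · simp [bipartiteGraph_not_adj_inr_inr]
  rw [Nat.card_coe_set_eq, himg, Set.ncard_image_of_injective, Set.ncard_coe_finset]
  rintro ⟨i, j⟩ ⟨i', j'⟩ h
  simpa using h

theorem RankedNoncrossingTree.card_edges_add_one (T : RankedNoncrossingTree l r) :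
    T.edges.card + 1 = l + r := by
  have h := (SimpleGraph.isTree_iff_connected_and_card.1 T.isTree).2
  rw [card_edgeSet_bipartiteGraph] at h
  simpa using h

end BipartiteGraph

/-- The number of elements of `S` that are at most `k`: the abscissa, after `k` steps, of the
lattice path whose horizontal steps are those with number in `S`. -/
def height (S : Finset ℕ) (k : ℕ) : ℕ := (S.filter (· ≤ k)).card

section Height

variable {n : ℕ} {S : Finset ℕ}

theorem height_zero (hS : S ⊆ Finset.Icc 1 (n - 1)) : height S 0 = 0 := by
  rw [height, Finset.card_eq_zero, Finset.filter_eq_empty_iff]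
  intro k hk
  have := Finset.mem_Icc.1 (hS hk)
  omega

theorem height_succ (S : Finset ℕ) (k : ℕ) :
    height S (k + 1) = height S k + if k + 1 ∈ S then 1 else 0 := by
  unfold height
  split_ifs with h
  · rw [← Finset.card_insert_of_notMem (a := k + 1) (by simp)]
    congr 1
    ext a
    simp only [Finset.mem_filter, Finset.mem_insert]
    constructor
    · rintro ⟨h1, h2⟩
      by_cases h3 : a = k + 1
      · exact Or.inl h3
      · exact Or.inr ⟨h1, by omega⟩
    · rintro (rfl | ⟨h1, h2⟩)
      · exact ⟨h, le_rfl⟩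
      · exact ⟨h1, by omega⟩
  · rw [add_zero]
    congr 1
    refine Finset.filter_congr fun a ha => ?_
    have : a ≠ k + 1 := fun h' => h (h' ▸ ha)
    omega

theorem height_mono (S : Finset ℕ) : Monotone (height S) := by
  refine monotone_nat_of_le_succ fun k => ?_
  rw [height_succ]
  exact Nat.le_add_right _ _

theorem height_le_card (S : Finset ℕ) (k : ℕ) : height S k ≤ S.card :=
  Finset.card_filter_le _ _

theorem height_pred_eq_card (hS : S ⊆ Finset.Icc 1 (n - 1)) : height S (n - 1) = S.card := by
  unfold height
  rw [Finset.filter_true_of_mem fun k hk => (Finset.mem_Icc.1 (hS hk)).2]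

/-- Horizontal and vertical steps add up: the ordinate of the lattice path is the height function of
the complementary set of steps. -/
theorem height_add_height_sdiff (hS : S ⊆ Finset.Icc 1 (n - 1)) {k : ℕ} (hk : k ≤ n - 1) :
    height S k + height (Finset.Icc 1 (n - 1) \ S) k = k := by
  induction k with
  | zero => rw [height_zero hS, height_zero Finset.sdiff_subset]
  | succ k ih =>
    have hmem : k + 1 ∈ Finset.Icc 1 (n - 1) := Finset.mem_Icc.2 ⟨by omega, hk⟩
    rw [height_succ, height_succ]
    have := ih (by omega)
    by_cases h : k + 1 ∈ S <;> simp [h] <;>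
      [omega; (have := Finset.mem_Icc.1 hmem; split_ifs <;> omega)]

theorem exists_height_eq (hS : S ⊆ Finset.Icc 1 (n - 1)) {k i : ℕ} (hi : i ≤ height S k) :
    ∃ k' ≤ k, height S k' = i := by
  induction k with
  | zero => exact ⟨0, le_rfl, by rw [height_zero hS] at hi ⊢; omega⟩
  | succ k ih =>
    rcases hi.eq_or_lt with h | h
    · exact ⟨k + 1, le_rfl, h.symm⟩
    · have : i ≤ height S k := by
        rw [height_succ] at h; split_ifs at h <;> omega
      obtain ⟨k', h1, h2⟩ := ih this
      exact ⟨k', by omega, h2⟩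

theorem mem_iff_height_lt (hS : S ⊆ Finset.Icc 1 (n - 1)) {k : ℕ} :
    k ∈ S ↔ 1 ≤ k ∧ height S (k - 1) < height S k := by
  cases k with
  | zero =>
    have : 0 ∉ S := fun h => by have := Finset.mem_Icc.1 (hS h); omega
    simp [this]
  | succ k =>
    rw [height_succ]
    by_cases h : k + 1 ∈ S <;> simp [h]

end Height

/-- `E` is the set of points of the lattice path with set `S` of horizontal steps. -/
def IsStaircase {l r : ℕ} (S : Finset ℕ) (E : Finset (Fin l × Fin r)) : Prop :=
  ∀ e, e ∈ E ↔ (e.1 : ℕ) = height S ((e.1 : ℕ) + (e.2 : ℕ))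

section Staircase

variable {n l r : ℕ} {S : Finset ℕ} {E : Finset (Fin l × Fin r)}

theorem card_sdiff_add_one (hn : 0 < n) (hS : S ⊆ Finset.Icc 1 (n - 1)) (hl : S.card + 1 = l)
    (hlr : l + r = n + 1) : (Finset.Icc 1 (n - 1) \ S).card + 1 = r := by
  have h := Finset.card_sdiff_add_card_eq_card hS
  rw [Nat.card_Icc] at h
  omega

theorem IsStaircase.exists_mem (hE : IsStaircase S E) (hS : S ⊆ Finset.Icc 1 (n - 1))
    (hl : S.card + 1 = l) (hlr : l + r = n + 1) {k : ℕ} (hk : k < n) :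
    ∃ e ∈ E, (e.1 : ℕ) = height S k ∧ (e.2 : ℕ) = height (Finset.Icc 1 (n - 1) \ S) k := by
  have h1 := height_le_card S k
  have h2 := height_le_card (Finset.Icc 1 (n - 1) \ S) k
  have h3 := card_sdiff_add_one (by omega) hS hl hlr
  refine ⟨(⟨height S k, by omega⟩, ⟨height (Finset.Icc 1 (n - 1) \ S) k, by omega⟩), ?_, rfl, rfl⟩
  rw [hE]
  simp only
  rw [height_add_height_sdiff hS (by omega)]

theorem IsStaircase.stepSet_subset {S' : Finset ℕ} (hE : IsStaircase S E) (hE' : IsStaircase S' E)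
    (hS : S ⊆ Finset.Icc 1 (n - 1)) (hS' : S' ⊆ Finset.Icc 1 (n - 1)) (hl : S.card + 1 = l)
    (hlr : l + r = n + 1) : S ⊆ S' := by
  have key : ∀ k < n, height S' k = height S k := by
    intro k hk
    obtain ⟨e, he, h1, h2⟩ := hE.exists_mem hS hl hlr hk
    have h3 := (hE' e).1 he
    have h4 := height_add_height_sdiff hS (k := k) (by omega)
    rw [h1, h2, h4] at h3
    exact h3.symm
  intro k hk
  have hk' := Finset.mem_Icc.1 (hS hk)
  rw [mem_iff_height_lt hS] at hk
  rw [mem_iff_height_lt hS', key _ (by omega), key _ (by omega)]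
  exact hk

theorem IsStaircase.stepSet_unique {S' : Finset ℕ} (hE : IsStaircase S E) (hE' : IsStaircase S' E)
    (hS : S ⊆ Finset.Icc 1 (n - 1)) (hS' : S' ⊆ Finset.Icc 1 (n - 1)) (hl : S.card + 1 = l)
    (hl' : S'.card + 1 = l) (hlr : l + r = n + 1) : S = S' :=
  (hE.stepSet_subset hE' hS hS' hl hlr).antisymm (hE'.stepSet_subset hE hS' hS hl' hlr)

/-- The edges of a non-crossing tree with `n` edges form a chain for the product order, and
`(i, j) ↦ i + j` is injective on it with values below `n`. Hence every value is taken once, and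
the chain is a lattice path. -/
theorem RankedNoncrossingTree.exists_isStaircase (hn : 0 < n) (hlr : l + r = n + 1)
    (T : RankedNoncrossingTree l r) :
    ∃ S ⊆ Finset.Icc 1 (n - 1), S.card + 1 = l ∧ IsStaircase S T.edges := by
  have hcard : T.edges.card = n := by have := T.card_edges_add_one; omega
  have hinj : ∀ e ∈ T.edges, ∀ f ∈ T.edges, (e.1 : ℕ) + e.2 = f.1 + f.2 → e = f := by
    intro e he f hf h
    have h1 := T.noncrossing e he f hf
    have h2 := T.noncrossing f hf e he
    simp only [Fin.lt_def, Fin.le_def] at h1 h2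
    have h3 : (e.1 : ℕ) = f.1 := by omega
    exact Prod.ext (Fin.ext h3) (Fin.ext (by omega))
  have hlt : ∀ e : Fin l × Fin r, (e.1 : ℕ) + e.2 < n := fun e => by
    have := e.1.2; have := e.2.2; omega
  -- By cardinality, `i + j` takes every value below `n`; `(x k, y k)` is the edge with value `k`.
  have himg : T.edges.image (fun e => (e.1 : ℕ) + e.2) = Finset.range n := by
    refine Finset.eq_of_subset_of_card_le ?_ ?_
    · intro k hk
      obtain ⟨e, -, rfl⟩ := Finset.mem_image.1 hk
      exact Finset.mem_range.2 (hlt e)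
    · rw [Finset.card_range, Finset.card_image_of_injOn fun e he f hf h => hinj e he f hf h, hcard]
  have hex : ∀ k, ∃ x y : ℕ, k < n → ∃ e ∈ T.edges, (e.1 : ℕ) = x ∧ (e.2 : ℕ) = y ∧ x + y = k := by
    intro k
    by_cases hk : k < n
    · obtain ⟨e, he, hek⟩ := Finset.mem_image.1 (himg ▸ Finset.mem_range.2 hk)
      exact ⟨e.1, e.2, fun _ => ⟨e, he, rfl, rfl, hek⟩⟩
    · exact ⟨0, 0, fun h => absurd h hk⟩
  choose x y hxy using hex
  have hstep : ∀ k, k + 1 < n → x k ≤ x (k + 1) ∧ x (k + 1) ≤ x k + 1 := by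
    intro k hk
    obtain ⟨e, he, he1, he2, he3⟩ := hxy k (by omega)
    obtain ⟨f, hf, hf1, hf2, hf3⟩ := hxy (k + 1) hk
    have h1 := T.noncrossing e he f hf
    have h2 := T.noncrossing f hf e he
    simp only [Fin.lt_def, Fin.le_def] at h1 h2
    omega
  set S := (Finset.Icc 1 (n - 1)).filter (fun k => x (k - 1) < x k) with hSdef
  have hS : S ⊆ Finset.Icc 1 (n - 1) := Finset.filter_subset _ _
  have hheight : ∀ k < n, height S k = x k := by
    intro k
    induction k with
    | zero =>
      intro h
      obtain ⟨e, -, -, -, h3⟩ := hxy 0 h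
      rw [height_zero hS]; omega
    | succ k ih =>
      intro hk
      have h1 := hstep k hk
      have h2 : k + 1 ∈ S ↔ x k < x (k + 1) := by
        simp only [hSdef, Finset.mem_filter, Finset.mem_Icc, Nat.add_sub_cancel]
        exact ⟨fun h => h.2, fun h => ⟨by omega, h⟩⟩
      rw [height_succ, ih (by omega)]
      split_ifs with h <;> rw [h2] at h <;> omega
  refine ⟨S, hS, ?_, fun e => ⟨fun he => ?_, fun he => ?_⟩⟩
  · obtain ⟨e, -, h1, h2, h3⟩ := hxy (n - 1) (by omega)
    have h4 := hheight (n - 1) (by omega)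
    rw [height_pred_eq_card hS] at h4
    have := e.1.2; have := e.2.2
    omega
  · obtain ⟨f, hf, h1, h2, h3⟩ := hxy _ (hlt e)
    rw [hheight _ (hlt e), ← h1, hinj e he f hf (by omega)]
  · obtain ⟨f, hf, h1, h2, h3⟩ := hxy _ (hlt e)
    rw [hheight _ (hlt e)] at he
    have : e = f := Prod.ext (Fin.ext (by omega)) (Fin.ext (by omega))
    rwa [this]

theorem IsStaircase.card_eq (hE : IsStaircase S E) (hS : S ⊆ Finset.Icc 1 (n - 1))
    (hl : S.card + 1 = l) (hlr : l + r = n + 1) : E.card = n := by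
  rw [← Finset.card_range n]
  refine Finset.card_nbij (fun e => (e.1 : ℕ) + e.2) ?_ ?_ ?_
  · intro e he
    have := e.1.2; have := e.2.2
    simp only [Finset.coe_range, Set.mem_Iio]; omega
  · intro e he f hf h
    have h1 := (hE e).1 he
    have h2 := (hE f).1 hf
    simp only at h
    rw [h, ← h2] at h1
    exact Prod.ext (Fin.ext h1) (Fin.ext (by omega))
  · intro k hk
    have hk' : k < n := by simpa using hk
    obtain ⟨e, he, h1, h2⟩ := hE.exists_mem hS hl hlr hk'
    refine ⟨e, he, ?_⟩
    simp only [h1, h2]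
    exact height_add_height_sdiff hS (by omega)

/-- Consecutive points of a lattice path share a coordinate, so its edges form a connected graph. -/
theorem IsStaircase.isTree (hn : 0 < n) (hE : IsStaircase S E) (hS : S ⊆ Finset.Icc 1 (n - 1))
    (hl : S.card + 1 = l) (hlr : l + r = n + 1) : (bipartiteGraph E).IsTree := by
  have hr := card_sdiff_add_one hn hS hl hlr
  have hS' : Finset.Icc 1 (n - 1) \ S ⊆ Finset.Icc 1 (n - 1) := Finset.sdiff_subset
  have hl0 : 0 < l := by omega
  have hsum : ∀ k < n, height S k + height (Finset.Icc 1 (n - 1) \ S) k = k := fun k hk =>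
    height_add_height_sdiff hS (by omega)
  have key : ∀ k < n, ∀ (i : Fin l) (j : Fin r), (i : ℕ) = height S k →
      (j : ℕ) = height (Finset.Icc 1 (n - 1) \ S) k →
      (bipartiteGraph E).Reachable (Sum.inl ⟨0, hl0⟩) (Sum.inl i) ∧
      (bipartiteGraph E).Reachable (Sum.inl ⟨0, hl0⟩) (Sum.inr j) := by
    intro k
    induction k with
    | zero =>
      intro hk i j hi hj
      rw [height_zero hS] at hi
      obtain rfl : i = ⟨0, hl0⟩ := Fin.ext hi
      refine ⟨SimpleGraph.Reachable.refl _, SimpleGraph.Adj.reachable ?_⟩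
      rw [bipartiteGraph_adj_inl_inr, hE, hj]
      simp only
      rw [height_zero hS', height_zero hS]
    | succ k ih =>
      intro hk i j hi hj
      obtain ⟨e, he, h1, h2⟩ := hE.exists_mem hS hl hlr (show k < n by omega)
      have hadj : (bipartiteGraph E).Adj (Sum.inl i) (Sum.inr j) := by
        rw [bipartiteGraph_adj_inl_inr, hE]
        simp only
        rw [hi, hj, hsum _ hk]
      have ih' := ih (by omega) e.1 e.2 h1 h2
      have hs1 := hsum k (by omega)
      have hs2 := hsum (k + 1) hk
      have hm1 := height_mono S (Nat.le_succ k)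
      have hm2 := height_mono (Finset.Icc 1 (n - 1) \ S) (Nat.le_succ k)
      have hor : i = e.1 ∨ j = e.2 := by
        rcases Nat.lt_or_ge (height S k) (height S (k + 1)) with h | h
        · right; apply Fin.ext; simp only [Nat.succ_eq_add_one] at *; omega
        · left; apply Fin.ext; simp only [Nat.succ_eq_add_one] at *; omega
      rcases hor with rfl | rfl
      · exact ⟨ih'.1, ih'.1.trans hadj.reachable⟩
      · exact ⟨ih'.2.trans hadj.symm.reachable, ih'.2⟩
  refine SimpleGraph.isTree_iff_connected_and_card.2 ⟨?_, ?_⟩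
  · refine (SimpleGraph.connected_iff_exists_forall_reachable _).2 ⟨Sum.inl ⟨0, hl0⟩, ?_⟩
    rintro (i | j)
    · obtain ⟨k, hk, hki⟩ := exists_height_eq hS (k := n - 1) (i := i)
        (by rw [height_pred_eq_card hS]; have := i.2; omega)
      obtain ⟨e, he, h1, h2⟩ := hE.exists_mem hS hl hlr (show k < n by omega)
      exact (key k (by omega) i e.2 hki.symm h2).1
    · obtain ⟨k, hk, hki⟩ := exists_height_eq hS' (k := n - 1) (i := j)
        (by rw [height_pred_eq_card hS']; have := j.2; omega)
      obtain ⟨e, he, h1, h2⟩ := hE.exists_mem hS hl hlr (show k < n by omega)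
      exact (key k (by omega) e.1 j h1 hki.symm).2
  · rw [card_edgeSet_bipartiteGraph, hE.card_eq hS hl hlr]
    simp [hlr]

theorem IsStaircase.noncrossing (hE : IsStaircase S E) (hS : S ⊆ Finset.Icc 1 (n - 1))
    (hlr : l + r = n + 1) {e f : Fin l × Fin r} (he : e ∈ E) (hf : f ∈ E) (hlt : e.1 < f.1) :
    e.2 ≤ f.2 := by
  rw [hE] at he hf
  rw [Fin.lt_def] at hlt
  rw [Fin.le_def]
  have h1 := e.1.2; have h2 := e.2.2; have h3 := f.1.2; have h4 := f.2.2
  have hle : (e.1 : ℕ) + e.2 ≤ f.1 + f.2 := by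
    by_contra! h
    have := height_mono S h.le
    omega
  have h5 := height_mono (Finset.Icc 1 (n - 1) \ S) hle
  have h6 := height_add_height_sdiff hS (k := (e.1 : ℕ) + e.2) (by omega)
  have h7 := height_add_height_sdiff hS (k := (f.1 : ℕ) + f.2) (by omega)
  omega

theorem exists_tree_isStaircase (hn : 0 < n) (hS : S ⊆ Finset.Icc 1 (n - 1)) (hl : S.card + 1 = l)
    (hlr : l + r = n + 1) : ∃ T : RankedNoncrossingTree l r, IsStaircase S T.edges := by
  have hE : IsStaircase S ((Finset.univ : Finset (Fin l × Fin r)).filter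
      (fun e => (e.1 : ℕ) = height S ((e.1 : ℕ) + (e.2 : ℕ)))) := fun e => by simp
  exact ⟨⟨_, hE.isTree hn hS hl hlr, fun e he f hf h => hE.noncrossing hS hlr he hf h⟩, hE⟩

theorem IsStaircase.leftmostHasDegreeOne_iff {T : RankedNoncrossingTree l r} (hn : 2 ≤ n)
    (hT : IsStaircase S T.edges) (hS : S ⊆ Finset.Icc 1 (n - 1)) (hl : S.card + 1 = l)
    (hlr : l + r = n + 1) : T.LeftmostHasDegreeOne ↔ 1 ∈ S := by
  have hl0 : 0 < l := by omega
  have hr := card_sdiff_add_one (by omega) hS hl hlr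
  have hmem : ∀ v, v ∈ (bipartiteGraph T.edges).neighborSet (Sum.inl ⟨0, hl0⟩) ↔
      ∃ j : Fin r, v = Sum.inr j ∧ height S j = 0 := by
    rintro (i | j)
    · simp [SimpleGraph.mem_neighborSet, bipartiteGraph_not_adj_inl_inl]
    · rw [SimpleGraph.mem_neighborSet, bipartiteGraph_adj_inl_inr, hT]
      simp [eq_comm]
  constructor
  · rintro ⟨_, hone⟩
    obtain ⟨v, hv⟩ := Set.ncard_eq_one.1 hone
    by_contra h1
    -- If the first step is not horizontal, both `y_0` and `y_1` are neighbours of `x_0`.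
    have hpos : 0 < (Finset.Icc 1 (n - 1) \ S).card :=
      Finset.card_pos.2 ⟨1, Finset.mem_sdiff.2 ⟨Finset.mem_Icc.2 ⟨le_rfl, by omega⟩, h1⟩⟩
    have h0 : height S 0 = 0 := height_zero hS
    have h0' : height S 1 = 0 := by
      have := height_succ S 0
      rw [if_neg (by simpa using h1), h0] at this
      simpa using this
    have ha := (hmem (Sum.inr ⟨0, by omega⟩)).2 ⟨_, rfl, h0⟩
    have hb := (hmem (Sum.inr ⟨1, by omega⟩)).2 ⟨_, rfl, h0'⟩
    rw [hv, Set.mem_singleton_iff] at ha hb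
    have := ha.trans hb.symm
    simp at this
  · intro h1
    refine ⟨hl0, Set.ncard_eq_one.2 ⟨Sum.inr ⟨0, by omega⟩, ?_⟩⟩
    ext v
    rw [hmem, Set.mem_singleton_iff]
    constructor
    · rintro ⟨j, rfl, hj⟩
      congr 1
      apply Fin.ext
      by_contra hj0
      have h2 := height_mono S (show 1 ≤ (j : ℕ) by simp only at hj0; omega)
      have h3 := height_succ S 0
      rw [if_pos (by simpa using h1)] at h3
      simp only [zero_add] at h3
      omega
    · rintro rfl
      exact ⟨_, rfl, height_zero hS⟩

end Staircase

/-! ### Counting the trees -/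

section Counting

variable {n : ℕ}

theorem BipartiteNoncrossingTree.eq_of_isStaircase {T T' : BipartiteNoncrossingTree (n + 1)}
    {S : Finset ℕ} (hT : IsStaircase S T.2.edges) (hT' : IsStaircase S T'.2.edges)
    (hl : T.1.1.1 = T'.1.1.1) : T = T' := by
  obtain ⟨⟨⟨l, r⟩, h⟩, T⟩ := T
  obtain ⟨⟨⟨l', r'⟩, h'⟩, T'⟩ := T'
  have h1 := Finset.HasAntidiagonal.mem_antidiagonal.1 h
  have h2 := Finset.HasAntidiagonal.mem_antidiagonal.1 h'
  simp only at hl h1 h2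
  subst hl
  obtain rfl : r = r' := by omega
  have : T.edges = T'.edges := by
    ext e
    exact (hT e).trans (hT' e).symm
  cases T
  cases T'
  simp only at this
  subst this
  rfl

/-- Bipartite non-crossing trees on `n + 1` vertices correspond to the sets of horizontal steps
of lattice paths with `n - 1` steps. -/
theorem exists_stepSet_bijection (hn : 0 < n) :
    ∃ F : BipartiteNoncrossingTree (n + 1) → Finset ℕ, F.Injective ∧
      Set.range F = ((Finset.Icc 1 (n - 1)).powerset : Set (Finset ℕ)) ∧
      ∀ T, (F T).card + 1 = T.1.1.1 ∧ IsStaircase (F T) T.2.edges := by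
  have hlr : ∀ T : BipartiteNoncrossingTree (n + 1), T.1.1.1 + T.1.1.2 = n + 1 := fun T =>
    Finset.HasAntidiagonal.mem_antidiagonal.1 T.1.2
  choose F hF1 hF2 hF3 using fun T : BipartiteNoncrossingTree (n + 1) =>
    T.2.exists_isStaircase hn (hlr T)
  refine ⟨F, fun T T' h => ?_, ?_, fun T => ⟨hF2 T, hF3 T⟩⟩
  · refine BipartiteNoncrossingTree.eq_of_isStaircase (hF3 T) (h ▸ hF3 T') ?_
    rw [← hF2 T, ← hF2 T', h]
  · ext S
    simp only [Set.mem_range, Finset.coe_powerset, Set.mem_preimage, Set.mem_powerset_iff,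
      Finset.coe_subset]
    constructor
    · rintro ⟨T, rfl⟩
      exact hF1 T
    · intro hS
      have hc := Finset.card_le_card hS
      rw [Nat.card_Icc] at hc
      obtain ⟨T, hT⟩ := exists_tree_isStaircase (r := n - S.card) hn hS rfl (by omega)
      refine ⟨⟨⟨(S.card + 1, n - S.card),
        Finset.HasAntidiagonal.mem_antidiagonal.2 (by simp only; omega)⟩, T⟩, ?_⟩
      exact (hF3 _).stepSet_unique hT (hF1 _) hS (hF2 _) rfl (hlr _)

theorem card_bipartiteNoncrossingTree (hn : 0 < n) :
    Nat.card (BipartiteNoncrossingTree (n + 1)) = 2 ^ (n - 1) := by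
  obtain ⟨F, hinj, hrange, -⟩ := exists_stepSet_bijection hn
  rw [← Set.ncard_univ, ← Set.ncard_image_of_injective _ hinj, Set.image_univ, hrange,
    Set.ncard_coe_finset, Finset.card_powerset, Nat.card_Icc]
  simp

theorem ncard_leftmostHasDegreeOne (hn : 2 ≤ n) :
    {T : BipartiteNoncrossingTree (n + 1) | T.2.LeftmostHasDegreeOne}.ncard = 2 ^ (n - 2) := by
  obtain ⟨F, hinj, hrange, hF⟩ := exists_stepSet_bijection (n := n) (by omega)
  have hsub : ∀ T, F T ⊆ Finset.Icc 1 (n - 1) := fun T => by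
    have : F T ∈ Set.range F := ⟨T, rfl⟩
    rw [hrange] at this
    exact Finset.mem_powerset.1 (Finset.mem_coe.1 this)
  have hdeg : ∀ T, T.2.LeftmostHasDegreeOne ↔ 1 ∈ F T := fun T =>
    (hF T).2.leftmostHasDegreeOne_iff hn (hsub T) (hF T).1
      (Finset.HasAntidiagonal.mem_antidiagonal.1 T.1.2)
  have himg : F '' {T | T.2.LeftmostHasDegreeOne} =
      ((Finset.Icc 2 (n - 1)).powerset.image (insert 1) : Set (Finset ℕ)) := by
    ext S
    simp only [Set.mem_image, Set.mem_ofPred_eq, hdeg, Finset.mem_coe, Finset.mem_image,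
      Finset.mem_powerset]
    constructor
    · rintro ⟨T, h1, rfl⟩
      refine ⟨(F T).erase 1, fun k hk => ?_, Finset.insert_erase h1⟩
      have h2 := Finset.mem_erase.1 hk
      have h3 := Finset.mem_Icc.1 (hsub T h2.2)
      exact Finset.mem_Icc.2 ⟨by omega, h3.2⟩
    · rintro ⟨S, hS, rfl⟩
      have : insert 1 S ∈ Set.range F := by
        rw [hrange]
        simp only [Finset.coe_powerset, Set.mem_preimage, Set.mem_powerset_iff, Finset.coe_subset]
        refine Finset.insert_subset (Finset.mem_Icc.2 ⟨le_rfl, by omega⟩) (hS.trans ?_)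
        exact Finset.Icc_subset_Icc (by omega) le_rfl
      obtain ⟨T, hT⟩ := this
      exact ⟨T, by rw [hT]; simp, hT⟩
  rw [← Set.ncard_image_of_injective _ hinj, himg, Set.ncard_coe_finset,
    Finset.card_image_of_injOn, Finset.card_powerset, Nat.card_Icc]
  · congr 1
  · intro A hA B hB h
    have hnot : ∀ C ∈ ((Finset.Icc 2 (n - 1)).powerset : Set (Finset ℕ)), 1 ∉ C := by
      intro C hC h1
      have := Finset.mem_Icc.1 (Finset.mem_powerset.1 hC h1)
      omega
    rw [← Finset.erase_insert (hnot A hA), ← Finset.erase_insert (hnot B hB), h]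

end Counting

/-! ### Realizing a tree -/

/-- The vertices of the path that visits, apart from the two ends, the vertices in `S`. -/
def pathVertices (n : ℕ) (S : Finset ℕ) : Finset (Fin (n + 1)) :=
  Finset.univ.filter fun v => v = 0 ∨ v = Fin.last n ∨ (v : ℕ) ∈ S

section PathVertices

variable {n l : ℕ} {S : Finset ℕ}

theorem mem_pathVertices {v : Fin (n + 1)} :
    v ∈ pathVertices n S ↔ v = 0 ∨ v = Fin.last n ∨ (v : ℕ) ∈ S := by
  simp [pathVertices]

theorem isTiling_pathVertices (n : ℕ) (S : Finset ℕ) :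
    IsTiling (consecutivePairs (pathVertices n S)) :=
  isTiling_consecutivePairs (mem_pathVertices.2 (Or.inl rfl))
    (mem_pathVertices.2 (Or.inr (Or.inl rfl)))

/-- The lattice path of `S` makes no horizontal step strictly inside a tile. -/
theorem height_eq_of_cover (hS : S ⊆ Finset.Icc 1 (n - 1)) {e : Fin (n + 1) × Fin (n + 1)}
    (he : e ∈ consecutivePairs (pathVertices n S)) {k : ℕ} (h1 : (e.1 : ℕ) ≤ k)
    (h2 : k < (e.2 : ℕ)) : height S k = height S e.1 := by
  unfold height
  congr 1
  refine Finset.filter_congr fun c hc => ⟨fun hck => ?_, fun hce => hce.trans h1⟩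
  have hc' := Finset.mem_Icc.1 (hS hc)
  have := he.2.2.2 ⟨c, by omega⟩ (mem_pathVertices.2 (Or.inr (Or.inr hc)))
  simp only [Fin.le_def] at this
  omega

/-- The right end of a tile that is not the last one belongs to `S`, so it is a horizontal step. -/
theorem height_lt_of_le (hS : S ⊆ Finset.Icc 1 (n - 1)) {e f : Fin (n + 1) × Fin (n + 1)}
    (he : e ∈ consecutivePairs (pathVertices n S)) (hf : f ∈ consecutivePairs (pathVertices n S))
    (hef : e.2 ≤ f.1) : height S e.1 < height S f.1 := by
  have hlt := he.2.2.1
  have hlast : e.2 ≠ Fin.last n := (hef.trans_lt (hf.2.2.1.trans_le (Fin.le_last _))).ne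
  have hzero : e.2 ≠ 0 := (Fin.zero_le _ |>.trans_lt hlt).ne'
  have hmem : (e.2 : ℕ) ∈ S := ((mem_pathVertices.1 he.2.1).resolve_left hzero).resolve_left hlast
  have h1 := ((mem_iff_height_lt hS).1 hmem).2
  have h2 : height S e.1 ≤ height S ((e.2 : ℕ) - 1) := height_mono S (by
    rw [Fin.lt_def] at hlt; omega)
  exact h2.trans_lt (h1.trans_le (height_mono S hef))

/-- The tiles of a path, numbered from left to right: the tile over the segment from `k` to
`k + 1` has number `height S k`. -/
theorem exists_tile_enumeration (hn : 0 < n) (hS : S ⊆ Finset.Icc 1 (n - 1))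
    (hl : S.card + 1 = l) : ∃ t : Fin l → Fin (n + 1) × Fin (n + 1),
      (∀ e, e ∈ consecutivePairs (pathVertices n S) ↔ ∃ i, t i = e) ∧
      (∀ i i', i < i' → (t i).2 ≤ (t i').1) ∧
      ∀ i, ∀ k < n, (((t i).1 : ℕ) ≤ k ∧ k < ((t i).2 : ℕ)) ↔ height S k = i := by
  have htil := isTiling_pathVertices n S
  have hex : ∀ i : Fin l, ∃ e ∈ consecutivePairs (pathVertices n S), height S e.1 = i := by
    intro i
    obtain ⟨k, hk, hki⟩ := exists_height_eq hS (k := n - 1) (i := i)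
      (by rw [height_pred_eq_card hS]; have := i.2; omega)
    obtain ⟨e, he, h1, h2⟩ := htil.cover k (by omega)
    exact ⟨e, he, by rw [← height_eq_of_cover hS he h1 h2, hki]⟩
  choose t ht1 ht2 using hex
  have huniq : ∀ e ∈ consecutivePairs (pathVertices n S), ∀ i : Fin l,
      height S e.1 = i → t i = e := by
    intro e he i hi
    rcases htil.eq_or_le _ (ht1 i) e he with h | h | h
    · exact h
    · have := height_lt_of_le hS (ht1 i) he h
      rw [ht2, hi] at this; omega
    · have := height_lt_of_le hS he (ht1 i) h
      rw [ht2, hi] at this; omega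
  refine ⟨t, fun e => ⟨fun he => ?_, ?_⟩, fun i i' hii' => ?_, fun i k hk => ⟨?_, fun hki => ?_⟩⟩
  · have := height_le_card S e.1
    exact ⟨⟨height S e.1, by omega⟩, huniq e he _ rfl⟩
  · rintro ⟨i, rfl⟩
    exact ht1 i
  · rw [Fin.lt_def] at hii'
    rcases htil.eq_or_le _ (ht1 i) _ (ht1 i') with h | h | h
    · have := ht2 i
      rw [h, ht2] at this; omega
    · exact h
    · have := height_lt_of_le hS (ht1 i') (ht1 i) h
      rw [ht2, ht2] at this; omega
  · rintro ⟨h1, h2⟩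
    rw [height_eq_of_cover hS (ht1 i) h1 h2, ht2]
  · obtain ⟨e, he, h1, h2⟩ := htil.cover k hk
    rw [height_eq_of_cover hS he h1 h2] at hki
    rw [huniq e he i hki]
    exact ⟨h1, h2⟩

end PathVertices

/-- The inner vertices of the three paths of the drawing attached to `S`: all of them for the spine,
those in `S` for the path below it, and the others for the path above it. -/
def sideSteps (n : ℕ) (S : Finset ℕ) : Side → Finset ℕ
  | Side.spine => Finset.Icc 1 (n - 1)
  | Side.below => S
  | Side.above => Finset.Icc 1 (n - 1) \ S

open Classical in
/-- The drawing of the spine, of the path through the vertices of `S` below it and of the path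
through the remaining vertices above it. -/
noncomputable def stairDrawing (n : ℕ) (S : Finset ℕ) : Drawing n :=
  (({Side.spine, Side.below, Side.above} : Finset Side) ×ˢ Finset.univ).filter
    fun e => e.2 ∈ consecutivePairs (pathVertices n (sideSteps n S e.1))

section StairDrawing

variable {n l r : ℕ} {S : Finset ℕ}

theorem mem_stairDrawing {e : DrawnEdge n} :
    e ∈ stairDrawing n S ↔ e.2 ∈ consecutivePairs (pathVertices n (sideSteps n S e.1)) := by
  have : e.1 = Side.spine ∨ e.1 = Side.below ∨ e.1 = Side.above := by
    rcases e.1 <;> simp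
  simp [stairDrawing, this]

theorem sideEdges_stairDrawing (s : Side) :
    (stairDrawing n S).sideEdges s = consecutivePairs (pathVertices n (sideSteps n S s)) := by
  ext e
  exact mem_stairDrawing

/-- The directed multigraph that underlies `stairDrawing`. -/
noncomputable def stairDAG (n : ℕ) (S : Finset ℕ) : DAG n where
  edges := (stairDrawing n S).val.map Prod.snd
  lt_of_mem := by
    intro e he
    obtain ⟨c, hc, rfl⟩ := Multiset.mem_map.1 he
    exact (mem_stairDrawing.1 hc).2.2.1

theorem pathVertices_Icc : pathVertices n (Finset.Icc 1 (n - 1)) = Finset.univ := by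
  ext v
  simp only [mem_pathVertices, Finset.mem_univ, iff_true, Finset.mem_Icc, Fin.ext_iff,
    Fin.val_zero, Fin.val_last]
  have := v.2
  omega

theorem isConventional_stairDrawing (hn : 2 ≤ n) (h1 : 1 ∈ S) :
    (stairDrawing n S).IsConventional (stairDAG n S) := by
  have hpath : ∀ s, IsSourceSinkPath ((stairDrawing n S).sideEdges s) := fun s =>
    isSourceSinkPath_iff.2 ⟨_, mem_pathVertices.2 (Or.inl rfl),
      mem_pathVertices.2 (Or.inr (Or.inl rfl)), sideEdges_stairDrawing s⟩
  have h1v : (((1 : Fin (n + 1)) : ℕ)) = 1 := by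
    rw [Fin.val_one', Nat.mod_eq_of_lt (by omega)]
  refine ⟨rfl, ?_, hpath _, ?_, hpath _⟩
  · rw [sideEdges_stairDrawing]
    ext ⟨i, j⟩
    simp only [sideSteps, pathVertices_Icc, consecutivePairs, Set.mem_ofPred_eq, Finset.mem_univ,
      true_and, true_implies, Fin.lt_def, Fin.le_def]
    constructor
    · rintro ⟨hlt, h⟩
      have := h ⟨i + 1, by omega⟩
      simp only at this
      omega
    · intro h
      exact ⟨by omega, fun c => by omega⟩
  · rw [sideEdges_stairDrawing]
    refine ⟨mem_pathVertices.2 (Or.inl rfl), mem_pathVertices.2 (Or.inr (Or.inr ?_)), ?_, ?_⟩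
    · rw [h1v]; exact h1
    · rw [Fin.lt_def, h1v]; simp
    · intro c _
      simp only [Fin.le_def, h1v, Fin.val_zero]
      omega

/-- The number of the three paths that visit a vertex. -/
def visits (n : ℕ) (S : Finset ℕ) (i : Fin (n + 1)) : ℕ :=
  (({Side.spine, Side.below, Side.above} : Finset Side).filter
    fun s => i ∈ pathVertices n (sideSteps n S s)).card

theorem visits_end {i : Fin (n + 1)} (hi : i = 0 ∨ i = Fin.last n) : visits n S i = 3 := by
  unfold visits
  rw [Finset.filter_true_of_mem fun s _ => mem_pathVertices.2 (by tauto)]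
  rfl

/-- An inner vertex lies on the spine and on exactly one of the two other paths. -/
theorem visits_inner {i : Fin (n + 1)} (h0 : i ≠ 0) (hlast : i ≠ Fin.last n) :
    visits n S i = 2 := by
  have hmem : (i : ℕ) ∈ Finset.Icc 1 (n - 1) := by
    have h1 : (i : ℕ) ≠ 0 := fun h => h0 (Fin.ext h)
    have h2 : (i : ℕ) ≠ n := fun h => hlast (Fin.ext h)
    have := i.2
    exact Finset.mem_Icc.2 ⟨by omega, by omega⟩
  unfold visits
  by_cases hi : (i : ℕ) ∈ S
  · simp [Finset.filter_insert, Finset.filter_singleton, mem_pathVertices, h0, hlast, sideSteps,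
      hi, -Finset.mem_Icc, hmem]
  · simp [Finset.filter_insert, Finset.filter_singleton, mem_pathVertices, h0, hlast, sideSteps,
      hi, -Finset.mem_Icc, hmem]

theorem outDegree_stairDAG {i : Fin (n + 1)} (hi : i ≠ Fin.last n) :
    (stairDAG n S).outDegree i = visits n S i := by
  unfold DAG.outDegree stairDAG
  simp only
  rw [Multiset.countP_map]
  change ((stairDrawing n S).filter fun e => e.2.1 = i).card = _
  refine Finset.card_nbij Prod.fst ?_ ?_ ?_
  · intro e he
    obtain ⟨h1, rfl⟩ := Finset.mem_filter.1 he
    rw [mem_stairDrawing] at h1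
    refine Finset.mem_filter.2 ⟨?_, h1.1⟩
    rcases e.1 <;> simp
  · rintro ⟨s, e⟩ he ⟨t, f⟩ hf h
    obtain rfl : s = t := h
    obtain ⟨h1, h2⟩ := Finset.mem_filter.1 he
    obtain ⟨h3, h4⟩ := Finset.mem_filter.1 hf
    rw [mem_stairDrawing] at h1 h3
    simp only at h2 h4
    have h5 := h1.2.2.1
    have h6 := h3.2.2.1
    rcases consecutivePairs_eq_or_le h1 h3 with h | h | h
    · simp only at h; rw [h]
    · exact absurd (h5.trans_le h) (by simp [h2, h4])
    · exact absurd (h6.trans_le h) (by simp [h2, h4])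
  · intro s hs
    obtain ⟨-, h⟩ := Finset.mem_filter.1 hs
    obtain ⟨j, hj⟩ := exists_consecutivePairs_snd (mem_pathVertices.2 (Or.inr (Or.inl rfl))) h hi
    exact ⟨(s, i, j), Finset.mem_filter.2 ⟨mem_stairDrawing.2 hj, rfl⟩, rfl⟩

theorem inDegree_stairDAG {j : Fin (n + 1)} (hj : j ≠ 0) :
    (stairDAG n S).inDegree j = visits n S j := by
  unfold DAG.inDegree stairDAG
  simp only
  rw [Multiset.countP_map]
  change ((stairDrawing n S).filter fun e => e.2.2 = j).card = _
  refine Finset.card_nbij Prod.fst ?_ ?_ ?_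
  · intro e he
    obtain ⟨h1, rfl⟩ := Finset.mem_filter.1 he
    rw [mem_stairDrawing] at h1
    refine Finset.mem_filter.2 ⟨?_, h1.2.1⟩
    rcases e.1 <;> simp
  · rintro ⟨s, e⟩ he ⟨t, f⟩ hf h
    obtain rfl : s = t := h
    obtain ⟨h1, h2⟩ := Finset.mem_filter.1 he
    obtain ⟨h3, h4⟩ := Finset.mem_filter.1 hf
    rw [mem_stairDrawing] at h1 h3
    simp only at h2 h4
    have h5 := h1.2.2.1
    have h6 := h3.2.2.1
    rcases consecutivePairs_eq_or_le h1 h3 with h | h | h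
    · simp only at h; rw [h]
    · exact absurd (h.trans_lt h6) (by simp [h2, h4])
    · exact absurd (h.trans_lt h5) (by simp [h2, h4])
  · intro s hs
    obtain ⟨-, h⟩ := Finset.mem_filter.1 hs
    obtain ⟨i, hi⟩ := exists_consecutivePairs_fst (mem_pathVertices.2 (Or.inl rfl)) h hj
    exact ⟨(s, i, j), Finset.mem_filter.2 ⟨mem_stairDrawing.2 hi, rfl⟩, rfl⟩

theorem DAG.outDegree_last (G : DAG n) : G.outDegree (Fin.last n) = 0 := by
  refine Multiset.countP_eq_zero.2 fun e he h => ?_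
  have := G.lt_of_mem e he
  rw [h] at this
  exact absurd this (Fin.le_last _).not_gt

theorem DAG.inDegree_zero (G : DAG n) : G.inDegree 0 = 0 := by
  refine Multiset.countP_eq_zero.2 fun e he h => ?_
  have := G.lt_of_mem e he
  rw [h] at this
  exact absurd this (Fin.not_lt_zero _)

theorem stairDAG_mem_fullFamily (hn : 0 < n) : stairDAG n S ∈ DAG.fullFamily n 3 := by
  have h0 : (0 : Fin (n + 1)) ≠ Fin.last n := by
    rw [Ne, Fin.ext_iff]; simp; omega
  refine ⟨?_, DAG.inDegree_zero _, fun i hi hi' => ⟨?_, ?_⟩, DAG.outDegree_last _, ?_⟩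
  · rw [outDegree_stairDAG h0, visits_end (Or.inl rfl)]
  · rw [outDegree_stairDAG hi', visits_inner hi hi']
  · rw [inDegree_stairDAG hi, visits_inner hi hi']
  · rw [inDegree_stairDAG h0.symm, visits_end (Or.inr rfl)]

/-- The truncated dual of `stairDrawing n S` is the staircase tree of `S`: the spine edge from `k`
to `k + 1` gives the tree edge `(i, j)` whose entries are the coordinates of the lattice path after
`k` steps. -/
theorem IsStaircase.isTruncatedDualOf {T : RankedNoncrossingTree l r} (hn : 2 ≤ n)
    (hT : IsStaircase S T.edges) (hS : S ⊆ Finset.Icc 1 (n - 1)) (h1 : 1 ∈ S)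
    (hl : S.card + 1 = l) (hlr : l + r = n + 1) : T.IsTruncatedDualOf (stairDrawing n S) := by
  have hn0 : 0 < n := by omega
  have hD := (isConventional_stairDrawing hn h1).isTiled
  obtain ⟨tA, hA, hAle, hAk⟩ := exists_tile_enumeration hn0 hS hl
  obtain ⟨tB, hB, hBle, hBk⟩ := exists_tile_enumeration hn0 (S := Finset.Icc 1 (n - 1) \ S)
    Finset.sdiff_subset (card_sdiff_add_one hn0 hS hl hlr)
  have hAlt : ∀ i, (tA i).1 < (tA i).2 := fun i => ((hA _).2 ⟨i, rfl⟩).2.2.1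
  have hBlt : ∀ j, (tB j).1 < (tB j).2 := fun j => ((hB _).2 ⟨j, rfl⟩).2.2.1
  have hAinj : Function.Injective tA := by
    refine Function.Injective.of_lt_imp_ne fun i i' h h' => ?_
    exact absurd (hAle i i' h) (by rw [h']; exact (hAlt i').not_ge)
  have hBinj : Function.Injective tB := by
    refine Function.Injective.of_lt_imp_ne fun j j' h h' => ?_
    exact absurd (hBle j j' h) (by rw [h']; exact (hBlt j').not_ge)
  -- The semicircle that bounds the face corresponding to a vertex of the tree.
  let d : Fin l ⊕ Fin r → DrawnEdge n :=
    Sum.elim (fun i => (Side.below, tA i)) (fun j => (Side.above, tB j))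
  have hdmem : ∀ u, d u ∈ stairDrawing n S := by
    rintro (i | j)
    · exact mem_stairDrawing.2 ((hA _).2 ⟨i, rfl⟩)
    · exact mem_stairDrawing.2 ((hB _).2 ⟨j, rfl⟩)
  have hdside : ∀ u, (d u).1 ≠ Side.spine := by
    rintro (i | j) <;> simp [d]
  have hdinj : Function.Injective d := by
    rintro (i | j) (i' | j') h
    · exact congrArg Sum.inl (hAinj (congrArg Prod.snd h))
    · exact absurd (congrArg Prod.fst h) (by simp [d])
    · exact absurd (congrArg Prod.fst h) (by simp [d])
    · exact congrArg Sum.inr (hBinj (congrArg Prod.snd h))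
  have hdisc : ∀ {e f : DrawnEdge n}, e ∈ stairDrawing n S → f ∈ stairDrawing n S →
      e.1 ≠ Side.spine → f.1 ≠ Side.spine → e.halfDisc = f.halfDisc → e = f :=
    fun he hf hs ht h => hD.halfDisc_injOn he hf hs ht h
  have hface : ∀ u, (d u).halfDisc ∈ (stairDrawing n S).boundedFaces := fun u =>
    (hD.mem_boundedFaces hn0).2 ⟨d u, hdmem u, hdside u, rfl⟩
  let φ : (Fin l ⊕ Fin r) ≃ (stairDrawing n S).boundedFaces :=
    Equiv.ofBijective (fun u => ⟨(d u).halfDisc, hface u⟩) (by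
      constructor
      · intro u v h
        exact hdinj (hdisc (hdmem u) (hdmem v) (hdside u) (hdside v) (congrArg Subtype.val h))
      · rintro ⟨F, hF⟩
        obtain ⟨⟨s, e⟩, he, hs, rfl⟩ := (hD.mem_boundedFaces hn0).1 hF
        rw [mem_stairDrawing] at he
        cases s
        · exact absurd rfl hs
        · obtain ⟨i, rfl⟩ := (hA _).1 he
          exact ⟨Sum.inl i, rfl⟩
        · obtain ⟨j, rfl⟩ := (hB _).1 he
          exact ⟨Sum.inr j, rfl⟩)
  have hφ : ∀ u, (φ u : Set (ℝ × ℝ)) = (d u).halfDisc := fun u => rfl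
  have hleft : ∀ u v, (d u).2.1 < (d u).2.2 → (d v).2.1 < (d v).2.2 → (d u).2.2 ≤ (d v).2.1 →
      IsLeftOf (φ u) (φ v) := by
    intro u v hu hv huv p hp q hq
    have h2 := (DrawnEdge.lt_of_power_neg hu hp.1).2
    have h3 := (DrawnEdge.lt_of_power_neg hv hq.1).1
    have h4 : (((d u).2.2 : ℕ) : ℝ) ≤ (((d v).2.1 : ℕ) : ℝ) := by exact_mod_cast huv
    linarith
  -- A spine edge from `k` to `k + 1` is a dual edge exactly for the tree edge `(i, j)` with
  -- `i + j = k`.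
  have hmem : ∀ u v c, c ∈ (stairDrawing n S).dualEdges (φ u) (φ v) ↔ c.1 = Side.spine ∧
      (c.2.2 : ℕ) = (c.2.1 : ℕ) + 1 ∧ ∃ i j, (i, j) ∈ T.edges ∧ (c.2.1 : ℕ) = i + j ∧
        ((u = Sum.inl i ∧ v = Sum.inr j) ∨ (u = Sum.inr j ∧ v = Sum.inl i)) := by
    intro u v c
    rw [hD.mem_dualEdges hn0 (φ u).2 (φ v).2]
    have hspine : c.1 = Side.spine → (c ∈ stairDrawing n S ↔ (c.2.2 : ℕ) = (c.2.1 : ℕ) + 1) := by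
      intro hcs
      have : c ∈ stairDrawing n S ↔ c.2 ∈ (stairDrawing n S).sideEdges Side.spine := by
        rw [← hcs]; rfl
      rw [this, hD.spine]; rfl
    constructor
    · rintro ⟨hc, hcs, a, ha, b, hb, has, hbs, ⟨ha1, ha2⟩, ⟨hb1, hb2⟩, heq⟩
      have hlen := (hspine hcs).1 hc
      have has' : a.1 ≠ Side.spine := by simp [has]
      have hbs' : b.1 ≠ Side.spine := by simp [hbs]
      obtain ⟨i, hi⟩ : ∃ i, d (Sum.inl i) = a := by
        have h := mem_stairDrawing.1 ha
        rw [has] at h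
        obtain ⟨i, hi⟩ := (hA _).1 h
        exact ⟨i, Prod.ext has.symm hi⟩
      obtain ⟨j, hj⟩ : ∃ j, d (Sum.inr j) = b := by
        have h := mem_stairDrawing.1 hb
        rw [hbs] at h
        obtain ⟨j, hj⟩ := (hB _).1 h
        exact ⟨j, Prod.ext hbs.symm hj⟩
      have hk : (c.2.1 : ℕ) < n := by have := c.2.2.2; omega
      subst hi hj
      have hi' : height S c.2.1 = i := (hAk i _ hk).1 ⟨ha1, by
        have : (c.2.2 : ℕ) ≤ (tA i).2 := ha2
        omega⟩
      have hj' : height (Finset.Icc 1 (n - 1) \ S) c.2.1 = j := (hBk j _ hk).1 ⟨hb1, by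
        have : (c.2.2 : ℕ) ≤ (tB j).2 := hb2
        omega⟩
      have hsum := height_add_height_sdiff hS (k := c.2.1) (by omega)
      rw [hi', hj'] at hsum
      refine ⟨hcs, hlen, i, j, ?_, hsum.symm, ?_⟩
      · rw [hT]
        simp only
        rw [hsum, hi']
      · have heq' : ({φ (Sum.inl i), φ (Sum.inr j)} : Set _) = {φ u, φ v} := by
          apply Set.image_injective.2 Subtype.val_injective
          simpa [Set.image_pair, hφ] using heq
        rcases Set.pair_eq_pair_iff.1 heq' with ⟨h, h'⟩ | ⟨h, h'⟩
        · exact Or.inl ⟨(φ.injective h).symm, (φ.injective h').symm⟩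
        · exact Or.inr ⟨(φ.injective h').symm, (φ.injective h).symm⟩
    · rintro ⟨hcs, hlen, i, j, hij, hk, huv⟩
      have hkn : (c.2.1 : ℕ) < n := by have := c.2.2.2; omega
      have hi : height S c.2.1 = i := by rw [hk]; exact ((hT _).1 hij).symm
      have hsum := height_add_height_sdiff hS (k := c.2.1) (by omega)
      have hj : height (Finset.Icc 1 (n - 1) \ S) c.2.1 = j := by omega
      obtain ⟨hi1, hi2⟩ := (hAk i _ hkn).2 hi
      obtain ⟨hj1, hj2⟩ := (hBk j _ hkn).2 hj
      refine ⟨(hspine hcs).2 hlen, hcs, d (Sum.inl i), hdmem _, d (Sum.inr j), hdmem _, rfl, rfl,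
        ⟨hi1, ?_⟩, ⟨hj1, ?_⟩, ?_⟩
      · change (c.2.2 : ℕ) ≤ (tA i).2; omega
      · change (c.2.2 : ℕ) ≤ (tB j).2; omega
      · rcases huv with ⟨rfl, rfl⟩ | ⟨rfl, rfl⟩
        · rfl
        · exact Set.pair_comm _ _
  have hadj : ∀ u v, (bipartiteGraph T.edges).Adj u v ↔ ∃ i j, (i, j) ∈ T.edges ∧
      ((u = Sum.inl i ∧ v = Sum.inr j) ∨ (u = Sum.inr j ∧ v = Sum.inl i)) := by
    rintro (i | j) (i' | j')
    · simp [bipartiteGraph_not_adj_inl_inl]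
    · simp [bipartiteGraph_adj_inl_inr]
    · rw [SimpleGraph.adj_comm]; simp [bipartiteGraph_adj_inl_inr]
    · simp [bipartiteGraph_not_adj_inr_inr]
  refine ⟨φ, fun i p hp => ?_, fun j p hp => ?_, fun i i' h => ?_, fun j j' h => ?_,
    fun u v huv => ?_, fun u v huv => ?_⟩
  · have : 0 < Side.below.sign * p.2 := hp.2
    simp only [Side.sign] at this
    change p.2 < 0
    linarith
  · have : 0 < Side.above.sign * p.2 := hp.2
    simp only [Side.sign] at this
    change 0 < p.2
    linarith
  · exact hleft _ _ (hAlt i) (hAlt i') (hAle i i' h)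
  · exact hleft _ _ (hBlt j) (hBlt j') (hBle j j' h)
  · obtain ⟨i, j, hij, huv⟩ := (hadj u v).1 huv
    have hi := i.2
    have hj := j.2
    refine Set.ncard_eq_one.2 ⟨(Side.spine, ⟨i + j, by omega⟩, ⟨i + j + 1, by omega⟩), ?_⟩
    ext c
    rw [hmem, Set.mem_singleton_iff]
    constructor
    · rintro ⟨hcs, hlen, i', j', -, hk, huv'⟩
      have hij' : i' = i ∧ j' = j := by
        rcases huv with ⟨rfl, rfl⟩ | ⟨rfl, rfl⟩
        · simpa [eq_comm] using huv'
        · simpa [eq_comm, and_comm] using huv'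
      obtain ⟨rfl, rfl⟩ := hij'
      exact Prod.ext hcs (Prod.ext (Fin.ext hk) (Fin.ext (by rw [hlen, hk])))
    · rintro rfl
      exact ⟨rfl, rfl, i, j, hij, rfl, huv⟩
  · refine Set.eq_empty_iff_forall_notMem.2 fun c hc => huv ?_
    obtain ⟨-, -, i, j, hij, -, huv'⟩ := (hmem u v c).1 hc
    exact (hadj u v).2 ⟨i, j, hij, huv'⟩

end StairDrawing

theorem isRealizable_iff_leftmostHasDegreeOne {n : ℕ} (hn : 2 ≤ n)
    (T : BipartiteNoncrossingTree (n + 1)) :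
    IsRealizable n T ↔ T.2.LeftmostHasDegreeOne := by
  constructor
  · rintro ⟨G, -, D, hD, hT⟩
    exact hT.leftmostHasDegreeOne (by omega) hD
  · intro h
    have hlr := Finset.HasAntidiagonal.mem_antidiagonal.1 T.1.2
    obtain ⟨S, hS, hl, hT⟩ := T.2.exists_isStaircase (n := n) (by omega) hlr
    have h1 := (hT.leftmostHasDegreeOne_iff hn hS hl hlr).1 h
    exact ⟨stairDAG n S, stairDAG_mem_fullFamily (by omega), stairDrawing n S,
      isConventional_stairDrawing hn h1, hT.isTruncatedDualOf hn hS h1 hl hlr⟩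

theorem mainTheorem8 (n : ℕ) (hn : 2 ≤ n) :
    Nat.card (BipartiteNoncrossingTree (n + 1)) = 2 ^ (n - 1) ∧
    {T : BipartiteNoncrossingTree (n + 1) | IsRealizable n T}.ncard = 2 ^ (n - 2) ∧
    ∀ T : BipartiteNoncrossingTree (n + 1), IsRealizable n T ↔ T.2.LeftmostHasDegreeOne := by
  have h := isRealizable_iff_leftmostHasDegreeOne hn
  refine ⟨card_bipartiteNoncrossingTree (by omega), ?_, h⟩
  simp only [h]
  exact ncard_leftmostHasDegreeOne hn
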